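/- **Setting.** A finite-state predictor consists of $k$ states with values $S_1,\dots,S_k$ and a transition function $\varphi(i,x)$. In state $i$ it predicts $S_i$; on reading the sample $x\in[0,1]$ it moves to state $\varphi(i,x)$. If $\hat x_1,\dots,\hat x_n$ are its predictions along $x_1,\dots,x_n\in[0,1]$ and $\bar x=\frac1n\sum_{t}x_t$, its regret on the sequence is $$\frac1n\sum_{t=1}^n (x_t-\hat x_t)^2-\frac1n\sum_{t=1}^n (x_t-\bar x)^2 .$$ Its maximal regret is the upper limit, as $n\to\infty$, of the supremum of the regret over all initial states and all $x_1,\dots,x_n\in[0,1]$. **Enhanced Exponential Decaying Memory (E-EDM) machine.** Let $R_d>0$ and $R=R_d/2$. For $x\in[0,1]$ put $$m_u(x)=\Big\lceil\tfrac{1-x-\sqrt R}{2\sqrt R}\Big\rceil,\qquad m_d(x)=\Big\lceil\tfrac{x-\sqrt R}{2\sqrt R}\Big\rceil ,$$ and let the segment $A(m_u,m_d)$ be the set of all $x\in[0,1]$ with $m_u(x)=m_u$, $m_d(x)=m_d$. Its spacing gap is $\Delta(m_u,m_d)=\frac{\sqrt R}{2m_um_d}$ (infinite if $m_um_d=0$).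 An E-EDM machine for $R_d$ is a finite-state predictor with states $S_1<\dots<S_k$ in $[0,1]$ such that: 1. every non-empty segment contains at least one state; 2. the distance of two consecutive states is at most the spacing gap of the segment that contains them (of each of the two segments, if they lie in different ones); 3. if two consecutive states lie in different segments $A_1,A_2$ and $\Delta(A_2)<\Delta(A_1)$, then, among the $m_u(A_1)+m_d(A_1)$ states closest to $A_2$ on the side of $A_1$ (or all states on that side, if there are fewer), any two consecutive ones are at distance at most $\Delta(A_2)$; 4. from state $i$, with $m_u=m_u(S_i)$ and $m_d=m_d(S_i)$, the machine jumps $j$ states, $-m_d\le j\le m_u$ (that is, $\varphi(i,x)=i+j$), if $S_i+(2j-1)\sqrt R\le x<S_i+(2j+1)\sqrt R$, where for $j=m_u$ the value $x=S_i+(2j+1)\sqrt R$ is also allowed. **Theorem.** For every $R_d>0$ there is an E-EDM machine for $R_d$, and every E-EDM machine for $R_d$ has maximal regret at most $R_d$. -/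

import Mathlib

namespace EEDM

/-- A deterministic time-invariant finite-state predictor with `k` states: the prediction
assigned to each state, and the transition function `φ(i, x)`. -/
structure FSM (k : ℕ) where
  value : Fin k → ℝ
  next : Fin k → ℝ → Fin k

/-- The state of the machine at each time, when it starts in state `i` and reads `x 0, x 1, …`. -/
def FSM.state {k : ℕ} (M : FSM k) (i : Fin k) (x : ℕ → ℝ) : ℕ → Fin k
  | 0 => i
  | t + 1 => M.next (M.state i x t) (x t)

/-- The empirical mean of `x 0, …, x (n - 1)`. -/
noncomputable def mean (x : ℕ → ℝ) (n : ℕ) : ℝ :=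
  (1 / (n : ℝ)) * ∑ t ∈ Finset.range n, x t

/-- The regret of the machine, started in state `i`, on the sequence `x 0, …, x (n - 1)`: its
mean square prediction error minus the empirical variance of the sequence. -/
noncomputable def FSM.regret {k : ℕ} (M : FSM k) (i : Fin k) (x : ℕ → ℝ) (n : ℕ) : ℝ :=
  (1 / (n : ℝ)) * ∑ t ∈ Finset.range n, (x t - M.value (M.state i x t)) ^ 2
    - (1 / (n : ℝ)) * ∑ t ∈ Finset.range n, (x t - mean x n) ^ 2

/-- The maximal regret: the worst regret over all initial states and all sequences of `n` samples
in `[0, 1]`, as the length `n` goes to infinity. -/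
noncomputable def FSM.maxRegret {k : ℕ} (M : FSM k) : EReal :=
  Filter.limsup
    (fun n : ℕ => ⨆ (i : Fin k) (x : ℕ → ℝ) (_ : ∀ t, x t ∈ Set.Icc (0 : ℝ) 1),
      ((M.regret i x n : ℝ) : EReal))
    Filter.atTop

/-- `m_u = ⌈(1 - x - √R) / (2 √R)⌉`, the maximum up jump at the point `x`. -/
noncomputable def mUp (R x : ℝ) : ℤ := ⌈(1 - x - √R) / (2 * √R)⌉

/-- `m_d = ⌈(x - √R) / (2 √R)⌉`, the maximum down jump at the point `x`. -/
noncomputable def mDown (R x : ℝ) : ℤ := ⌈(x - √R) / (2 * √R)⌉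

/-- The segment `A(m_u, m_d)` of `[0, 1]`. -/
def segment (R : ℝ) (mu md : ℤ) : Set ℝ :=
  {x | x ∈ Set.Icc (0 : ℝ) 1 ∧ mUp R x = mu ∧ mDown R x = md}

/-- The spacing gap `Δ(m_u, m_d) = √R / (2 m_u m_d)`, which is infinite if `m_u m_d = 0`. -/
noncomputable def spacing (R : ℝ) (mu md : ℤ) : EReal :=
  if mu * md = 0 then ⊤ else ((√R / (2 * (mu : ℝ) * (md : ℝ)) : ℝ) : EReal)

/-- The spacing gap prescribed by the segment that contains the point `x`. -/
noncomputable def spacingAt (R x : ℝ) : EReal := spacing R (mUp R x) (mDown R x)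

/-- The finite-state machine `M` is an Enhanced Exponential Decaying Memory machine with
parameter `R`. Two states `i`, `j` are consecutive if `(j : ℕ) = i + 1`. The prescribed spacing
gaps are read as upper bounds on the distance of consecutive states, since the length of a segment
need not be a multiple of its spacing gap. -/
structure IsEEDM {k : ℕ} (R : ℝ) (M : FSM k) : Prop where
  /-- The states are listed in increasing order. -/
  strictMono : StrictMono M.value
  /-- The states lie in `[0, 1]`. -/
  mem_Icc : ∀ i, M.value i ∈ Set.Icc (0 : ℝ) 1
  /-- There are states in each segment. -/
  exists_mem_segment : ∀ mu md : ℤ, (segment R mu md).Nonempty →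
    ∃ i, M.value i ∈ segment R mu md
  /-- Consecutive states are spread according to the spacing gap of their segment (of both their
  segments, if these differ). -/
  gap_le : ∀ i j : Fin k, (j : ℕ) = i + 1 →
    ((M.value j - M.value i : ℝ) : EReal) ≤ spacingAt R (M.value i) ∧
    ((M.value j - M.value i : ℝ) : EReal) ≤ spacingAt R (M.value j)
  /-- Let `a`, `b` be the consecutive states at the meeting point of two segments, and let the
  upper segment have the smaller spacing gap. Then the `m_u + m_d` states closest to the upper
  segment from below, `a, a - 1, …, a - (m_u + m_d) + 1`, have that smaller spacing gap, where
  `m_u`, `m_d` belong to the lower segment. -/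
  gap_le_of_upper_finer : ∀ a b : Fin k, (b : ℕ) = a + 1 →
    spacingAt R (M.value b) < spacingAt R (M.value a) →
    ∀ i j : Fin k, (j : ℕ) = i + 1 → j ≤ a →
      ((a : ℕ) : ℤ) < ((i : ℕ) : ℤ) + (mUp R (M.value a) + mDown R (M.value a)) →
      ((M.value j - M.value i : ℝ) : EReal) ≤ spacingAt R (M.value b)
  /-- The same with the roles of the two segments exchanged: the states
  `b, b + 1, …, b + (m_u + m_d) - 1` have the smaller spacing gap of the lower segment. -/
  gap_le_of_lower_finer : ∀ a b : Fin k, (b : ℕ) = a + 1 →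
    spacingAt R (M.value a) < spacingAt R (M.value b) →
    ∀ i j : Fin k, (j : ℕ) = i + 1 → b ≤ i →
      ((j : ℕ) : ℤ) < ((b : ℕ) : ℤ) + (mUp R (M.value b) + mDown R (M.value b)) →
      ((M.value j - M.value i : ℝ) : EReal) ≤ spacingAt R (M.value a)
  /-- From state `i`, with maximum jumps `m_u`, `m_d`, the machine jumps `j` states,
  `-m_d ≤ j ≤ m_u`, if the sample `x` satisfies `S_i + (2 j - 1) √R ≤ x < S_i + (2 j + 1) √R`;
  the last of these intervals is closed on the right, so that they cover `[0, 1]`. -/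
  next_eq : ∀ (i : Fin k) (x : ℝ), x ∈ Set.Icc (0 : ℝ) 1 → ∀ j : ℤ,
    -mDown R (M.value i) ≤ j → j ≤ mUp R (M.value i) →
    M.value i + (2 * (j : ℝ) - 1) * √R ≤ x →
    (x < M.value i + (2 * (j : ℝ) + 1) * √R ∨
      (j = mUp R (M.value i) ∧ x = M.value i + (2 * (j : ℝ) + 1) * √R)) →
    (((M.next i x : Fin k) : ℕ) : ℤ) = ((i : ℕ) : ℤ) + j

end EEDM

/-!
The regret of a sequence with mean `c` is its mean loss against the constant predictor `c`. So it
is enough to bound, for each `c` in `[0, 1]`, the loss `(x - S i) ^ 2 - (x - c) ^ 2` of a single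
jump from the state `i` on the sample `x` by `2 R + H (i + j) - H i`, with a potential `H` of the
states that is bounded independently of `c` (`Layout.exists_potential`).

Write `a = √R`, `y = c - S i` and `x = S i + 2 a j + δ`, where `|δ| ≤ a`. The loss is
`4 a y j + y (2 δ - y)`, whose second term is at most `R`. With the increments
`4 a (c - (S m + S (m + 1)) / 2) + E m` of the potential, an up jump by `n` states requires that
the `E m` on the passed gaps add up to its excess `4 a A + y (2 δ - y) - 2 R` or more
(`excess`), where `A ≤ g n ^ 2 / 2` if the gaps are at most `g`; a down jump requires the mirrored
upper bound. Choosing each `E m` separately, between the largest of the averages that up jumps ask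
for and the least that down jumps allow, works if the requests of an up jump and a down jump that
pass a common gap are compatible. That is the main step, `Layout.excess_add_le`.

If an up jump by `n` and a down jump by `n'` pass gaps of size at most `a / (2 n n')`, they are
compatible (`excess_add_le_of_gap_le`). The conditions on the spacing near the meeting points of
segments yield such a bound on the gaps, with one exception: a full jump by `U + 1` up and one by
`d + 1` down across a short segment with maximum jumps `U`, `d`, whose neighbours are finer. There
the bound `R` on `y (2 δ - y)` is too generous. Samples that cause such full jumps lie so close to
the end of `[0, 1]` that `δ` is nearly `-a` for the up jump and `a` for the down jump, and the
terms `y (2 δ - y)` make up for the larger gaps (`excess_add_le_of_full_jumps`).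

Gaps between two states with `mDown = 0` need not be small, but no down jump passes them, so that
a large `E m` is allowed there; and a large negative one between two states with `mUp = 0`.

A machine exists since the conditions bound the gaps only from above: a fine grid, with a point of
each non-empty segment added, satisfies them (`exists_isEEDM`).
-/

namespace EEDM

/-! ### The maximum jumps and the spacing gap -/

lemma mUp_one_sub (R x : ℝ) : mUp R (1 - x) = mDown R x := by
  simp [mUp, mDown]

lemma mDown_one_sub (R x : ℝ) : mDown R (1 - x) = mUp R x := by
  simp [mUp, mDown]

lemma mDown_le_iff {R : ℝ} (hR : 0 < R) {x : ℝ} {n : ℤ} :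
    mDown R x ≤ n ↔ x ≤ (2 * n + 1) * √R := by
  have h : 0 < √R := Real.sqrt_pos.2 hR
  rw [mDown, Int.ceil_le, div_le_iff₀ (by positivity)]
  constructor <;> intro h <;> linarith

lemma mUp_le_iff {R : ℝ} (hR : 0 < R) {x : ℝ} {n : ℤ} :
    mUp R x ≤ n ↔ 1 - x ≤ (2 * n + 1) * √R := by
  rw [← mDown_one_sub, mDown_le_iff hR]

lemma lt_mUp_iff {R : ℝ} (hR : 0 < R) {x : ℝ} {n : ℤ} :
    n < mUp R x ↔ (2 * n + 1) * √R < 1 - x := by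
  rw [← not_le, mUp_le_iff hR, not_le]

lemma lt_mDown_iff {R : ℝ} (hR : 0 < R) {x : ℝ} {n : ℤ} :
    n < mDown R x ↔ (2 * n + 1) * √R < x := by
  rw [← not_le, mDown_le_iff hR, not_le]

lemma mDown_nonneg {R : ℝ} (hR : 0 < R) {x : ℝ} (hx : 0 ≤ x) : 0 ≤ mDown R x := by
  have h : 0 < √R := Real.sqrt_pos.2 hR
  have : (-1 : ℤ) < mDown R x := (lt_mDown_iff hR).2 (by push_cast; linarith)
  omega

lemma mUp_nonneg {R : ℝ} (hR : 0 < R) {x : ℝ} (hx : x ≤ 1) : 0 ≤ mUp R x := by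
  rw [← mDown_one_sub]
  exact mDown_nonneg hR (by linarith)

lemma mDown_mono {R : ℝ} (hR : 0 < R) {x y : ℝ} (h : x ≤ y) : mDown R x ≤ mDown R y :=
  (mDown_le_iff hR).2 (h.trans ((mDown_le_iff hR).1 le_rfl))

lemma mUp_anti {R : ℝ} (hR : 0 < R) {x y : ℝ} (h : x ≤ y) : mUp R y ≤ mUp R x := by
  rw [← mDown_one_sub, ← mDown_one_sub]
  exact mDown_mono hR (by linarith)

lemma spacing_comm (R : ℝ) (m n : ℤ) : spacing R m n = spacing R n m := by
  simp only [spacing, mul_comm m n, mul_right_comm (2 : ℝ) (m : ℝ) (n : ℝ)]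

lemma spacingAt_one_sub (R x : ℝ) : spacingAt R (1 - x) = spacingAt R x := by
  rw [spacingAt, mUp_one_sub, mDown_one_sub, spacing_comm, spacingAt]

lemma spacing_of_pos {R : ℝ} {m n : ℤ} (hm : 1 ≤ m) (hn : 1 ≤ n) :
    spacing R m n = ((√R / (2 * (m : ℝ) * (n : ℝ)) : ℝ) : EReal) := by
  rw [spacing, if_neg (mul_ne_zero (by omega) (by omega))]

lemma spacing_succ_lt {R : ℝ} (hR : 0 < R) {m n : ℤ} (hm : 1 ≤ m) (hn : 0 ≤ n) :
    spacing R m (n + 1) < spacing R m n := by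
  have h : 0 < √R := Real.sqrt_pos.2 hR
  rw [spacing_of_pos hm (by omega)]
  rcases hn.eq_or_lt with rfl | hn
  · simp [spacing, EReal.coe_lt_top]
  · rw [spacing_of_pos hm (by omega), EReal.coe_lt_coe_iff]
    have hm' : (1 : ℝ) ≤ m := by exact_mod_cast hm
    have hn' : (1 : ℝ) ≤ n := by exact_mod_cast hn
    push_cast
    gcongr
    linarith

/-- At the lower end of the points with maximum up jump less than `mUp R x`, this jump has dropped
by exactly one. If `mDown` has grown at this point already, then it has grown at some point before,
where `mUp` is still the same. So both never change at once without a segment in between. -/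
lemma exists_segment_between {R : ℝ} (hR : 0 < R) {x y : ℝ} (hxy : mUp R y < mUp R x)
    (hne : ¬ (mUp R y = mUp R x - 1 ∧ mDown R y = mDown R x)) :
    ∃ z, x ≤ z ∧ z ≤ y ∧ ¬ (mUp R z = mUp R x ∧ mDown R z = mDown R x) ∧
      ¬ (mUp R z = mUp R y ∧ mDown R z = mDown R y) := by
  have h : 0 < √R := Real.sqrt_pos.2 hR
  set u := mUp R x with hu
  set z : ℝ := 1 - (2 * (u : ℝ) - 1) * √R with hz
  have hxz : x < z := by
    have := (lt_mUp_iff hR (x := x) (n := u - 1)).1 (by omega)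
    push_cast at this
    rw [hz]; linarith
  have hzy : z ≤ y := by
    have := (mUp_le_iff hR (x := y) (n := u - 1)).1 (by omega)
    push_cast at this
    rw [hz]; linarith
  have hzu : mUp R z = u - 1 := by
    apply le_antisymm
    · rw [mUp_le_iff hR]; push_cast; rw [hz]; linarith
    · have : u - 2 < mUp R z := by
        rw [lt_mUp_iff hR]; push_cast; rw [hz]; linarith
      omega
  by_cases hzy' : mUp R z = mUp R y ∧ mDown R z = mDown R y
  · have hlt : mDown R x < mDown R z :=
      lt_of_le_of_ne (mDown_mono hR hxz.le) fun h' => hne ⟨by omega, by omega⟩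
    have h1 := (lt_mDown_iff hR).1 hlt
    have h2 := (mDown_le_iff hR (x := x)).1 le_rfl
    have h3 : mDown R x < mDown R (((2 * (mDown R x : ℝ) + 1) * √R + z) / 2) :=
      (lt_mDown_iff hR).2 (by linarith)
    have h4 : u - 1 < mUp R (((2 * (mDown R x : ℝ) + 1) * √R + z) / 2) := by
      rw [lt_mUp_iff hR]; push_cast; rw [hz] at h1 ⊢; linarith
    refine ⟨((2 * (mDown R x : ℝ) + 1) * √R + z) / 2, ?_, ?_, fun h' => ?_, fun h' => ?_⟩ <;>
      first | omega | linarith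
  · exact ⟨z, hxz.le, hzy, by omega, hzy'⟩

/-! ### The layout of the states and its reflection -/

/-- What the states of an E-EDM machine satisfy, without the transition function. The states are
indexed by the integers `i` with `0 ≤ i < k`; the values of `S` elsewhere are irrelevant. Unlike
`IsEEDM`, the conditions are invariant under reflection of the unit interval. -/
structure Layout (R : ℝ) (k : ℤ) (S : ℤ → ℝ) : Prop where
  lt : ∀ i j, 0 ≤ i → i < j → j < k → S i < S j
  mem_Icc : ∀ i, 0 ≤ i → i < k → S i ∈ Set.Icc (0 : ℝ) 1
  exists_mem_segment : ∀ mu md : ℤ, (segment R mu md).Nonempty →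
    ∃ i, 0 ≤ i ∧ i < k ∧ S i ∈ segment R mu md
  gap_le_left : ∀ i, 0 ≤ i → i + 1 < k → ((S (i + 1) - S i : ℝ) : EReal) ≤ spacingAt R (S i)
  gap_le_right : ∀ i, 0 ≤ i → i + 1 < k →
    ((S (i + 1) - S i : ℝ) : EReal) ≤ spacingAt R (S (i + 1))
  gap_le_of_upper_finer : ∀ a, 0 ≤ a → a + 1 < k → spacingAt R (S (a + 1)) < spacingAt R (S a) →
    ∀ i, 0 ≤ i → i + 1 ≤ a → a < i + (mUp R (S a) + mDown R (S a)) →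
      ((S (i + 1) - S i : ℝ) : EReal) ≤ spacingAt R (S (a + 1))
  gap_le_of_lower_finer : ∀ a, 0 ≤ a → a + 1 < k → spacingAt R (S a) < spacingAt R (S (a + 1)) →
    ∀ i, a + 1 ≤ i → i + 1 < k → i < a + (mUp R (S (a + 1)) + mDown R (S (a + 1))) →
      ((S (i + 1) - S i : ℝ) : EReal) ≤ spacingAt R (S a)

/-- The mirror image of `k` states under `x ↦ 1 - x`, again listed in increasing order. -/
def reflect (k : ℤ) (S : ℤ → ℝ) (i : ℤ) : ℝ := 1 - S (k - 1 - i)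

lemma reflect_reflect (k : ℤ) (S : ℤ → ℝ) : reflect k (reflect k S) = S := by
  funext i
  simp [reflect]

lemma reflect_apply_sub (k : ℤ) (S : ℤ → ℝ) (i : ℤ) : reflect k S (k - 1 - i) = 1 - S i := by
  simp [reflect]

lemma mUp_reflect (R : ℝ) (k : ℤ) (S : ℤ → ℝ) (i : ℤ) :
    mUp R (reflect k S i) = mDown R (S (k - 1 - i)) := mUp_one_sub _ _

lemma mDown_reflect (R : ℝ) (k : ℤ) (S : ℤ → ℝ) (i : ℤ) :
    mDown R (reflect k S i) = mUp R (S (k - 1 - i)) := mDown_one_sub _ _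

lemma Layout.reflect {R : ℝ} {k : ℤ} {S : ℤ → ℝ} (L : Layout R k S) :
    Layout R k (reflect k S) where
  lt i j hi hij hj := by
    have := L.lt (k - 1 - j) (k - 1 - i) (by omega) (by omega) (by omega)
    simp only [EEDM.reflect]; linarith
  mem_Icc i hi hk := by
    have := L.mem_Icc (k - 1 - i) (by omega) (by omega)
    simp only [EEDM.reflect, Set.mem_Icc] at *
    constructor <;> linarith
  exists_mem_segment mu md h := by
    obtain ⟨x, ⟨h0, h1⟩, hu, hd⟩ := h
    obtain ⟨i, hi, hk, ⟨h0', h1'⟩, hu', hd'⟩ := L.exists_mem_segment md mu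
      ⟨1 - x, ⟨by linarith, by linarith⟩, by rwa [mUp_one_sub], by rwa [mDown_one_sub]⟩
    refine ⟨k - 1 - i, by omega, by omega, ?_⟩
    rw [reflect_apply_sub]
    exact ⟨⟨by linarith, by linarith⟩, by rwa [mUp_one_sub], by rwa [mDown_one_sub]⟩
  gap_le_left i hi hk := by
    have := L.gap_le_right (k - 1 - (i + 1)) (by omega) (by omega)
    rw [show k - 1 - (i + 1) + 1 = k - 1 - i by ring] at this
    simp only [EEDM.reflect, spacingAt_one_sub]
    rwa [sub_sub_sub_cancel_left]
  gap_le_right i hi hk := by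
    have := L.gap_le_left (k - 1 - (i + 1)) (by omega) (by omega)
    rw [show k - 1 - (i + 1) + 1 = k - 1 - i by ring] at this
    simp only [EEDM.reflect, spacingAt_one_sub]
    rwa [sub_sub_sub_cancel_left]
  gap_le_of_upper_finer a ha hk h i hi hia hai := by
    simp only [EEDM.reflect, spacingAt_one_sub, mUp_one_sub, mDown_one_sub] at *
    have e : k - 1 - (a + 1) + 1 = k - 1 - a := by ring
    have := L.gap_le_of_lower_finer (k - 1 - (a + 1)) (by omega) (by omega) (by rwa [e])
      (k - 1 - (i + 1)) (by omega) (by omega) (by rw [e]; omega)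
    rw [show k - 1 - (i + 1) + 1 = k - 1 - i by ring] at this
    rwa [sub_sub_sub_cancel_left]
  gap_le_of_lower_finer a ha hk h i hi hia hai := by
    simp only [EEDM.reflect, spacingAt_one_sub, mUp_one_sub, mDown_one_sub] at *
    have e : k - 1 - (a + 1) + 1 = k - 1 - a := by ring
    have := L.gap_le_of_upper_finer (k - 1 - (a + 1)) (by omega) (by omega) (by rwa [e])
      (k - 1 - (i + 1)) (by omega) (by omega) (by omega)
    rw [show k - 1 - (i + 1) + 1 = k - 1 - i by ring, e] at this
    rwa [sub_sub_sub_cancel_left]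

namespace Layout

variable {R : ℝ} {k : ℤ} {S : ℤ → ℝ}

lemma le (L : Layout R k S) {i j : ℤ} (hi : 0 ≤ i) (hij : i ≤ j) (hj : j < k) : S i ≤ S j := by
  rcases hij.eq_or_lt with rfl | h
  · exact le_rfl
  · exact (L.lt i j hi h hj).le

lemma mUp_anti (L : Layout R k S) (hR : 0 < R) {i j : ℤ} (hi : 0 ≤ i) (hij : i ≤ j) (hj : j < k) :
    mUp R (S j) ≤ mUp R (S i) :=
  EEDM.mUp_anti hR (L.le hi hij hj)

lemma mDown_mono (L : Layout R k S) (hR : 0 < R) {i j : ℤ} (hi : 0 ≤ i) (hij : i ≤ j)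
    (hj : j < k) : mDown R (S i) ≤ mDown R (S j) :=
  EEDM.mDown_mono hR (L.le hi hij hj)

lemma mUp_nonneg (L : Layout R k S) (hR : 0 < R) {i : ℤ} (hi : 0 ≤ i) (hk : i < k) :
    0 ≤ mUp R (S i) :=
  EEDM.mUp_nonneg hR (L.mem_Icc i hi hk).2

lemma mDown_nonneg (L : Layout R k S) (hR : 0 < R) {i : ℤ} (hi : 0 ≤ i) (hk : i < k) :
    0 ≤ mDown R (S i) :=
  EEDM.mDown_nonneg hR (L.mem_Icc i hi hk).1

lemma exists_state_between (L : Layout R k S) (hR : 0 < R) {i j : ℤ} (hi : 0 ≤ i) (hj : j < k)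
    (hij : i < j) (h : mUp R (S j) < mUp R (S i))
    (hne : ¬ (mUp R (S j) = mUp R (S i) - 1 ∧ mDown R (S j) = mDown R (S i))) :
    ∃ p, i < p ∧ p < j ∧ ¬ (mUp R (S p) = mUp R (S i) ∧ mDown R (S p) = mDown R (S i)) ∧
      ¬ (mUp R (S p) = mUp R (S j) ∧ mDown R (S p) = mDown R (S j)) := by
  obtain ⟨z, hiz, hzj, hzi', hzj'⟩ := exists_segment_between hR h hne
  have hz : z ∈ Set.Icc (0 : ℝ) 1 :=
    ⟨(L.mem_Icc i hi (by omega)).1.trans hiz, hzj.trans (L.mem_Icc j (by omega) hj).2⟩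
  obtain ⟨p, hp, hpk, -, hpu, hpd⟩ := L.exists_mem_segment _ _ ⟨z, hz, rfl, rfl⟩
  have h1 := EEDM.mUp_anti hR hiz
  have h2 := EEDM.mUp_anti hR hzj
  have h3 := EEDM.mDown_mono hR hiz
  have h4 := EEDM.mDown_mono hR hzj
  refine ⟨p, ?_, ?_, by rwa [hpu, hpd], by rwa [hpu, hpd]⟩
  · by_contra! hpi
    have h5 := L.mUp_anti hR hp hpi (by omega)
    have h6 := L.mDown_mono hR hp hpi (by omega)
    omega
  · by_contra! hpj
    have h5 := L.mUp_anti hR (by omega) hpj hpk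
    have h6 := L.mDown_mono hR (by omega) hpj hpk
    omega

lemma mUp_succ_of_lt (L : Layout R k S) (hR : 0 < R) {i : ℤ} (hi : 0 ≤ i) (hk : i + 1 < k)
    (h : mUp R (S (i + 1)) < mUp R (S i)) :
    mUp R (S (i + 1)) = mUp R (S i) - 1 ∧ mDown R (S (i + 1)) = mDown R (S i) := by
  by_contra hne
  obtain ⟨p, h1, h2, -⟩ := L.exists_state_between hR hi hk (by omega) h hne
  omega

/-- From one state to the next, at most one of the two maximum jumps changes, by one. -/
lemma step (L : Layout R k S) (hR : 0 < R) {i : ℤ} (hi : 0 ≤ i) (hk : i + 1 < k) :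
    (mUp R (S (i + 1)) = mUp R (S i) ∧ mDown R (S (i + 1)) = mDown R (S i)) ∨
    (mUp R (S (i + 1)) = mUp R (S i) - 1 ∧ mDown R (S (i + 1)) = mDown R (S i)) ∨
    (mUp R (S (i + 1)) = mUp R (S i) ∧ mDown R (S (i + 1)) = mDown R (S i) + 1) := by
  rcases (L.mUp_anti hR hi (by omega) hk).eq_or_lt with h | h
  · rcases (L.mDown_mono hR hi (by omega) hk).eq_or_lt with h' | h'
    · omega
    · have e : k - 1 - (k - 1 - (i + 1) + 1) = i := by ring
      have e' : k - 1 - (k - 1 - (i + 1)) = i + 1 := by ring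
      have := L.reflect.mUp_succ_of_lt hR (i := k - 1 - (i + 1)) (by omega) (by omega)
        (by rw [mUp_reflect, mUp_reflect, e, e']; exact h')
      rw [mUp_reflect, mUp_reflect, mDown_reflect, mDown_reflect, e, e'] at this
      omega
  · have := L.mUp_succ_of_lt hR hi hk h
    omega

lemma mUp_le_add (L : Layout R k S) (hR : 0 < R) {i : ℤ} (hi : 0 ≤ i) (n : ℕ) (hk : i + n < k) :
    mUp R (S i) ≤ mUp R (S (i + n)) + n := by
  induction n with
  | zero => simp
  | succ n ih =>
    push_cast at hk ⊢
    have h1 := ih (by omega)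
    have h2 := L.step hR (i := i + n) (by omega) (by omega)
    rw [add_assoc] at h2
    omega

/-! ### The gaps within reach of a state -/

lemma gap_le_of_spacing {x y : ℝ} {m n : ℤ} (hm : 1 ≤ m) (hn : 1 ≤ n)
    (h : ((x - y : ℝ) : EReal) ≤ spacing R m n) : x - y ≤ √R / (2 * m * n) := by
  rwa [spacing_of_pos hm hn, EReal.coe_le_coe_iff] at h

/-- All gaps that an up jump passes obey the spacing gap of the state where the jump starts: if
the next segment is coarser, it is finely spaced near its lower end. -/
lemma gap_le_up (L : Layout R k S) (hR : 0 < R) (n : ℕ) {i : ℤ} (hi : 0 ≤ i) (hk : i + n + 1 < k)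
    (hu : (n : ℤ) < mUp R (S i)) (hd : 1 ≤ mDown R (S i)) :
    S (i + n + 1) - S (i + n) ≤ √R / (2 * mUp R (S i) * mDown R (S i)) := by
  induction n generalizing i with
  | zero =>
    simp only [Nat.cast_zero, add_zero] at *
    exact gap_le_of_spacing (by omega) hd (L.gap_le_left i hi hk)
  | succ n ih =>
    push_cast at *
    have ih' := ih (i := i + 1) (by omega) (by omega)
    rw [show i + 1 + (n : ℤ) = i + (n + 1) by ring] at ih'
    rcases L.step hR hi (by omega) with ⟨h1, h2⟩ | ⟨h1, h2⟩ | ⟨h1, h2⟩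
    · rw [h1, h2] at ih'
      exact ih' (by omega) hd
    · refine gap_le_of_spacing (by omega) hd (L.gap_le_of_lower_finer i hi (by omega) ?_ _
        (by omega) (by omega) (by omega))
      rw [spacingAt, spacingAt, h1, h2, spacing_comm R (_ - 1), spacing_comm]
      have := spacing_succ_lt hR (m := mDown R (S i)) (n := mUp R (S i) - 1) hd (by omega)
      rwa [sub_add_cancel] at this
    · rw [h1, h2] at ih'
      refine (ih' (by omega) (by omega)).trans ?_
      have h3 : (1 : ℝ) ≤ mDown R (S i) := by exact_mod_cast hd
      have h4 : (1 : ℝ) ≤ mUp R (S i) := by exact_mod_cast (by omega : 1 ≤ mUp R (S i))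
      push_cast
      gcongr
      linarith

lemma gap_le_up' (L : Layout R k S) (hR : 0 < R) {i l : ℤ} (hi : 0 ≤ i) (hil : i ≤ l)
    (hk : l + 1 < k) (hu : l < i + mUp R (S i)) (hd : 1 ≤ mDown R (S i)) :
    S (l + 1) - S l ≤ √R / (2 * mUp R (S i) * mDown R (S i)) := by
  obtain ⟨n, rfl⟩ := Int.le.dest hil
  exact L.gap_le_up hR n hi hk (by omega) hd

lemma gap_le_down (L : Layout R k S) (hR : 0 < R) {i l : ℤ} (hi : i < k) (hil : l + 1 ≤ i)
    (hl : 0 ≤ l) (hd : i ≤ l + mDown R (S i)) (hu : 1 ≤ mUp R (S i)) :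
    S (l + 1) - S l ≤ √R / (2 * mUp R (S i) * mDown R (S i)) := by
  have := L.reflect.gap_le_up' hR (i := k - 1 - i) (l := k - 1 - (l + 1)) (by omega) (by omega)
    (by omega) (by rw [mUp_reflect, sub_sub_cancel]; omega)
    (by rw [mDown_reflect, sub_sub_cancel]; exact hu)
  rw [mUp_reflect, mDown_reflect, sub_sub_cancel, reflect_apply_sub,
    show k - 1 - (l + 1) + 1 = k - 1 - l by ring, reflect_apply_sub, sub_sub_sub_cancel_left,
    mul_right_comm] at this
  exact this

lemma exists_mDown_step (L : Layout R k S) (hR : 0 < R) {i : ℤ} (hi : 0 ≤ i) (n : ℕ)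
    (hk : i + n < k) (hd : mDown R (S (i + n)) = mDown R (S i) + 1) :
    ∃ a, i ≤ a ∧ a + 1 ≤ i + n ∧ mDown R (S a) = mDown R (S i) ∧
      mDown R (S (a + 1)) = mDown R (S i) + 1 := by
  induction n with
  | zero => simp at hd
  | succ n ih =>
    push_cast at *
    have h1 := L.mDown_mono hR hi (show i ≤ i + n by omega) (by omega)
    have h2 := L.mDown_mono hR (show 0 ≤ i + n by omega) (show i + (n : ℤ) ≤ i + (n + 1) by omega)
      (by omega)
    by_cases h : mDown R (S (i + n)) = mDown R (S i) + 1
    · obtain ⟨a, ha⟩ := ih (by omega) h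
      exact ⟨a, by omega⟩
    · exact ⟨i + n, by omega, by omega, by omega, by rw [add_assoc]; omega⟩

/-- Around the point where the maximum down jump grows, the smaller spacing gap of the upper
segment is obeyed far enough for all jumps that pass it. -/
lemma gap_le_of_mDown_succ (L : Layout R k S) (hR : 0 < R) {i j l : ℤ} (hi : 0 ≤ i) (hij : i < j)
    (hj : j < k) (hu : mUp R (S j) = mUp R (S i)) (hd : mDown R (S j) = mDown R (S i) + 1)
    (hu1 : 1 ≤ mUp R (S i)) (hl : 0 ≤ l) (hlk : l + 1 < k)
    (hjl : j - mUp R (S i) - mDown R (S i) ≤ l) (hli : l ≤ i + mUp R (S i)) :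
    S (l + 1) - S l ≤ √R / (2 * mUp R (S j) * mDown R (S j)) := by
  obtain ⟨n, rfl⟩ := Int.le.dest hij.le
  obtain ⟨a, hia, haj, hda, hda'⟩ := L.exists_mDown_step hR hi n hj hd
  have hd0 := L.mDown_nonneg hR hi (by omega)
  have h1 := L.mUp_anti hR hi hia (by omega)
  have h2 := L.mUp_anti hR (by omega) (show a ≤ a + 1 by omega) (by omega)
  have h3 := L.mUp_anti hR (by omega) haj (by omega)
  have e1 : mUp R (S (a + 1)) = mUp R (S (i + n)) := by omega
  have e2 : mDown R (S (a + 1)) = mDown R (S (i + n)) := by omega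
  rw [← e1, ← e2]
  rcases lt_trichotomy l a with h | rfl | h
  · refine gap_le_of_spacing (by omega) (by omega) (L.gap_le_of_upper_finer a (by omega)
      (by omega) ?_ l hl (by omega) (by omega))
    have := spacing_succ_lt hR hu1 hd0
    rw [spacingAt, spacingAt, hda, hda', e1, hu, show mUp R (S a) = mUp R (S i) by omega]
    exact this
  · exact gap_le_of_spacing (by omega) (by omega) (L.gap_le_right l hl hlk)
  · exact L.gap_le_up' hR (by omega) (by omega) hlk (by omega) (by omega)

lemma gap_le_of_mUp_pred (L : Layout R k S) (hR : 0 < R) {i j l : ℤ} (hi : 0 ≤ i) (hij : i < j)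
    (hj : j < k) (hd : mDown R (S j) = mDown R (S i)) (hu : mUp R (S i) = mUp R (S j) + 1)
    (hd1 : 1 ≤ mDown R (S j)) (hl : 0 ≤ l) (hlk : l + 1 < k)
    (hjl : j ≤ l + 1 + mDown R (S j)) (hli : l + 1 ≤ i + mUp R (S j) + mDown R (S j)) :
    S (l + 1) - S l ≤ √R / (2 * mUp R (S i) * mDown R (S i)) := by
  have := L.reflect.gap_le_of_mDown_succ hR (i := k - 1 - j) (j := k - 1 - i)
    (l := k - 1 - (l + 1)) (by omega) (by omega) (by omega)
  simp only [mUp_one_sub, mDown_one_sub, reflect_apply_sub,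
    show k - 1 - (l + 1) + 1 = k - 1 - l by ring, sub_sub_sub_cancel_left] at this
  rw [mul_right_comm]
  exact this (by omega) (by omega) (by omega) (by omega) (by omega) (by omega) (by omega)

/-- The jump may start in a segment with infinite spacing gap, at its last state. -/
lemma gap_le_of_one_le_mDown_succ (L : Layout R k S) (hR : 0 < R) {i l : ℤ} (hi : 0 ≤ i)
    (hil : i ≤ l) (hk : l + 1 < k) (hu : l < i + mUp R (S i)) (hd : 1 ≤ mDown R (S (i + 1))) :
    S (l + 1) - S l ≤ √R / (2 * mUp R (S i)) := by
  have h : 0 < √R := Real.sqrt_pos.2 hR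
  have hu' : (1 : ℝ) ≤ mUp R (S i) := by exact_mod_cast (by omega : 1 ≤ mUp R (S i))
  rcases (L.mDown_nonneg hR hi (by omega)).eq_or_lt with h0 | h0
  · rcases L.step hR hi (by omega) with ⟨h1, h2⟩ | ⟨h1, h2⟩ | ⟨h1, h2⟩ <;> try omega
    have h3 : S (l + 1) - S l ≤ √R / (2 * mUp R (S (i + 1)) * mDown R (S (i + 1))) := by
      rcases hil.eq_or_lt with rfl | hil
      · exact gap_le_of_spacing (by omega) (by omega) (L.gap_le_right i hi hk)
      · exact L.gap_le_up' hR (by omega) (by omega) hk (by omega) hd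
    rw [h1, h2, ← h0] at h3
    simpa using h3
  · refine (L.gap_le_up' hR hi hil hk hu h0).trans ?_
    have hd' : (1 : ℝ) ≤ mDown R (S i) := by exact_mod_cast h0
    apply div_le_div_of_nonneg_left h.le (by positivity)
    nlinarith

end Layout

/-! ### Up moves and their excess -/

/-- The sum, over the `n` gaps above the state `i`, of the height of the midpoint of the gap above
the state `i`. -/
noncomputable def area (S : ℤ → ℝ) (i : ℤ) (n : ℕ) : ℝ :=
  ∑ r ∈ Finset.range n, ((S (i + r) + S (i + r + 1)) / 2 - S i)

lemma area_succ (S : ℤ → ℝ) (i : ℤ) (n : ℕ) :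
    area S i (n + 1) = (n + 1 / 2) * (S (i + 1) - S i) + area S (i + 1) n := by
  simp only [area, Finset.sum_range_succ', Finset.sum_sub_distrib, Finset.sum_const,
    Finset.card_range, nsmul_eq_mul, Nat.cast_add, Nat.cast_one, Nat.cast_zero, add_zero]
  have : ∀ r : ℕ, i + ((r : ℤ) + 1) = i + 1 + r := fun r => by ring
  simp only [this]
  ring

lemma area_le {S : ℤ → ℝ} {i : ℤ} {n : ℕ} {g : ℝ}
    (h : ∀ l, i ≤ l → l < i + n → S (l + 1) - S l ≤ g) : area S i n ≤ g * n ^ 2 / 2 := by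
  induction n generalizing i with
  | zero => simp [area]
  | succ n ih =>
    rw [area_succ]
    have h1 := ih (i := i + 1) fun l h1 h2 => h l (by omega) (by push_cast; omega)
    have h2 := h i le_rfl (by push_cast; omega)
    have h3 : ((n : ℝ) + 1 / 2) * (S (i + 1) - S i) ≤ (n + 1 / 2) * g := by gcongr
    push_cast
    nlinarith

lemma sub_le_of_gap_le {S : ℤ → ℝ} {i : ℤ} {n : ℕ} {g : ℝ}
    (h : ∀ l, i ≤ l → l < i + n → S (l + 1) - S l ≤ g) : S (i + n) - S i ≤ n * g := by
  induction n with
  | zero => simp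
  | succ n ih =>
    have h1 := ih fun l h1 h2 => h l h1 (by push_cast; omega)
    have h2 := h (i + n) (by omega) (by push_cast; omega)
    push_cast
    rw [← add_assoc]
    linarith

/-- From the state `i` the machine may jump up by `n ≥ 1` states on reading `x`. A down jump is an
up jump of the reflected states, on reading `1 - x`. -/
structure UpMove (R : ℝ) (k : ℤ) (S : ℤ → ℝ) (i : ℤ) (n : ℕ) (x : ℝ) : Prop where
  nonneg : 0 ≤ i
  one_le : 1 ≤ n
  lt : i + n < k
  le_mUp : (n : ℤ) ≤ mUp R (S i)
  le_one : x ≤ 1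
  abs_sub_le : |x - S i - 2 * n * √R| ≤ √R

/-- What an up jump contributes to the regret against the constant predictor `c`, less the part
`4 √R ∑ (c - midpoint)` over the passed gaps, which telescopes, and less the allowance `2 R`. -/
noncomputable def excess (R : ℝ) (S : ℤ → ℝ) (c : ℝ) (i : ℤ) (n : ℕ) (x : ℝ) : ℝ :=
  4 * √R * area S i n + (c - S i) * (2 * (x - S i - 2 * n * √R) - (c - S i)) - 2 * R

variable {R : ℝ} {k : ℤ} {S : ℤ → ℝ}

lemma UpMove.excess_le (hR : 0 < R) {i : ℤ} {n : ℕ} {x : ℝ} (h : UpMove R k S i n x) (c : ℝ) :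
    excess R S c i n x ≤ 4 * √R * area S i n - R := by
  have h1 := _root_.abs_le.1 h.abs_sub_le
  have h2 := Real.sq_sqrt hR.le
  rw [excess]
  nlinarith [sq_nonneg (x - S i - 2 * n * √R - (c - S i))]

lemma reflect_gap_le {i : ℤ} {n : ℕ} {g : ℝ}
    (h : ∀ l, i - n ≤ l → l < i → S (l + 1) - S l ≤ g) (l : ℤ) (h1 : k - 1 - i ≤ l)
    (h2 : l < k - 1 - i + n) : reflect k S (l + 1) - reflect k S l ≤ g := by
  have := h (k - 1 - (l + 1)) (by omega) (by omega)
  rw [show k - 1 - (l + 1) + 1 = k - 1 - l by ring] at this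
  simp only [reflect]
  linarith

/-- If the spacing gap that two moves see is small compared to both of them, then the pair causes
no excess. This is where the value `√R / (2 m_u m_d)` comes from. -/
lemma excess_add_le_of_gap_le (hR : 0 < R) {i i' : ℤ} {n n' : ℕ} {x x' c g : ℝ}
    (U : UpMove R k S i n x) (D : UpMove R k (reflect k S) (k - 1 - i') n' x')
    (hg : 2 * n * n' * g ≤ √R)
    (h : ∀ l, i ≤ l → l < i + n → S (l + 1) - S l ≤ g)
    (h' : ∀ l, i' - n' ≤ l → l < i' → S (l + 1) - S l ≤ g) :
    n' * excess R S c i n x + n * excess R (reflect k S) (1 - c) (k - 1 - i') n' x' ≤ 0 := by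
  have ha : 0 < √R := Real.sqrt_pos.2 hR
  have h1 := U.excess_le hR c
  have h2 := D.excess_le hR (1 - c)
  have h3 := area_le h
  have h4 := area_le (reflect_gap_le (k := k) h')
  have hs := Real.sq_sqrt hR.le
  have e1 : excess R S c i n x ≤ 2 * √R * g * n ^ 2 - R := by nlinarith
  have e2 : excess R (reflect k S) (1 - c) (k - 1 - i') n' x' ≤ 2 * √R * g * n' ^ 2 - R := by
    nlinarith
  calc _ ≤ (n' : ℝ) * (2 * √R * g * n ^ 2 - R) + n * (2 * √R * g * n' ^ 2 - R) := by gcongr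
    _ = (n + n') * (√R * (2 * n * n' * g) - R) := by ring
    _ ≤ 0 := by
      apply mul_nonpos_of_nonneg_of_nonpos (by positivity)
      nlinarith

lemma two_mul_mul_spacing_le {a : ℝ} (ha : 0 < a) {n n' : ℕ} {u d : ℤ} (hn : 1 ≤ n)
    (hn' : 1 ≤ n') (hu : (n : ℤ) ≤ u) (hd : (n' : ℤ) ≤ d) :
    2 * n * n' * (a / (2 * u * d)) ≤ a := by
  have h1 : (1 : ℝ) ≤ n := by exact_mod_cast hn
  have h2 : (1 : ℝ) ≤ n' := by exact_mod_cast hn'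
  have h3 : (n : ℝ) ≤ u := by exact_mod_cast hu
  have h4 : (n' : ℝ) ≤ d := by exact_mod_cast hd
  have h5 : (n : ℝ) * n' ≤ u * d := mul_le_mul h3 h4 (by linarith) (by linarith)
  rw [← mul_div_assoc, div_le_iff₀ (by nlinarith)]
  nlinarith

/-! ### Two full jumps across a short coarse segment -/

lemma full_jumps_ineq_aux {U d : ℝ} (hU : 1 ≤ U) (hd : 1 ≤ d) (h : d ≤ U ∨ U + 1 ≤ d) :
    (2 * U + 1) / ((U + 1) * d) + 1 / U ≤ 1 + 1 / (d + 1) + min 1 ((U + 1) / (d + 1)) := by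
  rcases h with h | h
  · obtain ⟨f, hf, rfl⟩ : ∃ f, 0 ≤ f ∧ d = 1 + f := ⟨d - 1, by linarith, by ring⟩
    obtain ⟨e, he, rfl⟩ : ∃ e, 0 ≤ e ∧ U = 1 + f + e := ⟨U - (1 + f), by linarith, by ring⟩
    rw [min_eq_left (by rw [le_div_iff₀ (by positivity)]; linarith),
      div_add_div _ _ (by positivity) (by positivity),
      show 1 + 1 / (1 + f + 1) + 1 = (2 * (1 + f + 1) + 1) / (1 + f + 1) by field_simp; ring,
      div_le_div_iff₀ (by positivity) (by positivity), ← sub_nonneg]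
    ring_nf
    positivity
  · obtain ⟨f, hf, rfl⟩ : ∃ f, 0 ≤ f ∧ U = 1 + f := ⟨U - 1, by linarith, by ring⟩
    obtain ⟨e, he, rfl⟩ : ∃ e, 0 ≤ e ∧ d = 1 + f + 1 + e :=
      ⟨d - (1 + f + 1), by linarith, by ring⟩
    rw [min_eq_right (by rw [div_le_iff₀ (by positivity)]; linarith),
      div_add_div _ _ (by positivity) (by positivity),
      show 1 + 1 / (1 + f + 1 + e + 1) + (1 + f + 1) / (1 + f + 1 + e + 1) =
        (1 + f + 1 + e + 1 + 1 + (1 + f + 1)) / (1 + f + 1 + e + 1) by field_simp,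
      div_le_div_iff₀ (by positivity) (by positivity), ← sub_nonneg]
    ring_nf
    positivity

lemma full_jumps_ineq {U d q : ℝ} (hU : 1 ≤ U) (hd : 1 ≤ d) (h : d ≤ U ∨ U + 1 ≤ d)
    (hq : 0 ≤ q) :
    (2 * U + 1) / ((U + 1) * d) + U / (d + 1) + (U + 1) / U ≤
      2 + 2 * q + q ^ 2 + (U + 1) / (d + 1) * (2 - 2 * q + q ^ 2) := by
  have h1 := full_jumps_ineq_aux hU hd h
  have h2 : (U + 1) / U = 1 + 1 / U := by field_simp
  have h3 : U / (d + 1) = (U + 1) / (d + 1) - 1 / (d + 1) := by rw [← sub_div]; ring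
  have h4 : 0 < (U + 1) / (d + 1) := by positivity
  rw [h2, h3]
  set κ := (U + 1) / (d + 1)
  have h5 := min_le_left 1 κ
  have h6 := min_le_right 1 κ
  have h7 : 0 ≤ min 1 κ := le_min zero_le_one h4.le
  set m := min 1 κ
  nlinarith [mul_nonneg (sub_nonneg.2 h6) (sq_nonneg (1 - q)), mul_nonneg (sub_nonneg.2 h5) hq,
    mul_nonneg h7 (sq_nonneg q)]

/-- An up jump by `U + 1` and a down jump by `d + 1` may meet across a coarse segment with maximum
jumps `U`, `d`. Both are possible only for samples near the ends of the unit interval, which lie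
at the inner ends of their intervals (`hx`, `hx'`). For `c ≥ S i` the second summand of the excess
of the up jump is therefore negative or zero, which makes up for the larger gaps. -/
lemma excess_add_le_of_full_jumps (hR : 0 < R) {i i' : ℤ} {u d : ℕ} {x x' c : ℝ} (hu : 1 ≤ u)
    (hd : 1 ≤ d) (D : UpMove R k (reflect k S) (k - 1 - i') (d + 1) x')
    (h0 : S i ≤ S i') (hz : S i' - S i ≤ √R)
    (hx : x - S i - 2 * (u + 1 : ℕ) * √R ≤ S i' - S i - √R)
    (hx' : x' - (1 - S i') - 2 * (d + 1 : ℕ) * √R ≤ S i' - S i - √R)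
    (hg : ∀ l, i ≤ l → l < i + (u + 1 : ℕ) → S (l + 1) - S l ≤ √R / (2 * (u + 1) * d))
    (hg1 : ∀ l, i + 1 ≤ l → l < i + (u + 1 : ℕ) → S (l + 1) - S l ≤ √R / (2 * u * (d + 1)))
    (hg' : ∀ l, i' - (d + 1 : ℕ) ≤ l → l < i' → S (l + 1) - S l ≤ √R / (2 * u * (d + 1)))
    (hc : S i ≤ c) :
    (d + 1 : ℕ) * excess R S c i (u + 1) x +
      (u + 1 : ℕ) * excess R (reflect k S) (1 - c) (k - 1 - i') (d + 1) x' ≤ 0 := by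
  have ha : 0 < √R := Real.sqrt_pos.2 hR
  have hs := Real.sq_sqrt hR.le
  have hu' : (1 : ℝ) ≤ u := by exact_mod_cast hu
  have hd' : (1 : ℝ) ≤ d := by exact_mod_cast hd
  have hA' := area_le (reflect_gap_le (k := k) hg')
  have hδ' := (_root_.abs_le.1 D.abs_sub_le).2
  simp only [excess, reflect_apply_sub] at *
  push_cast at *
  set a := √R with haR
  set δ := x - S i - 2 * (u + 1) * a
  set δ' := x' - (1 - S i') - 2 * (d + 1) * a
  have hA'2 : 4 * a * area (reflect k S) (k - 1 - i') (d + 1) ≤ R * ((d + 1) / u) := by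
    calc _ ≤ 4 * a * (a / (2 * u * (d + 1)) * (d + 1) ^ 2 / 2) := by gcongr
      _ = a ^ 2 * ((d + 1) / u) := by field_simp; ring
      _ = _ := by rw [hs]
  rcases le_total c (S i') with hc' | hc'
  · have hA := area_le hg
    have hA2 : 4 * a * area S i (u + 1) ≤ R * ((u + 1) / d) := by
      calc _ ≤ 4 * a * (a / (2 * (u + 1) * d) * ((u + 1 : ℕ) : ℝ) ^ 2 / 2) := by gcongr
        _ = a ^ 2 * ((u + 1) / d) := by push_cast; field_simp; ring
        _ = _ := by rw [hs]
    have hT : (c - S i) * (2 * δ - (c - S i)) ≤ 0 :=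
      mul_nonpos_of_nonneg_of_nonpos (by linarith) (by linarith)
    have hT' : (1 - c - (1 - S i')) * (2 * δ' - (1 - c - (1 - S i'))) ≤ 0 :=
      mul_nonpos_of_nonneg_of_nonpos (by linarith) (by linarith)
    have h1 : ((d : ℝ) + 1) * ((u + 1) / d) ≤ 2 * (u + 1) := by
      rw [← mul_div_assoc, div_le_iff₀ (by positivity)]; nlinarith
    have h2 : ((u : ℝ) + 1) * ((d + 1) / u) ≤ 2 * (d + 1) := by
      rw [← mul_div_assoc, div_le_iff₀ (by positivity)]; nlinarith
    calc _ ≤ ((d : ℝ) + 1) * (R * ((u + 1) / d) + 0 - 2 * R) +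
          (u + 1) * (R * ((d + 1) / u) + 0 - 2 * R) := by gcongr
      _ = R * (((d : ℝ) + 1) * ((u + 1) / d) - 2 * (u + 1)) +
          R * (((u : ℝ) + 1) * ((d + 1) / u) - 2 * (d + 1)) := by ring
      _ ≤ 0 := add_nonpos (mul_nonpos_of_nonneg_of_nonpos hR.le (by linarith))
          (mul_nonpos_of_nonneg_of_nonpos hR.le (by linarith))
  · obtain ⟨q, hq, hcq⟩ : ∃ q, 0 ≤ q ∧ c = S i' + q * a :=
      ⟨(c - S i') / a, div_nonneg (by linarith) ha.le, by field_simp; ring⟩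
    have hA : 4 * a * area S i (u + 1) ≤
        R * ((2 * u + 1) / ((u + 1) * d) + u / (d + 1)) := by
      have h1 := hg i le_rfl (by omega)
      have h2 := area_le (S := S) (i := i + 1) (n := u) fun l h1 h2 => hg1 l h1 (by omega)
      rw [area_succ]
      calc _ ≤ 4 * a * ((u + 1 / 2) * (a / (2 * (u + 1) * d)) +
            a / (2 * u * (d + 1)) * u ^ 2 / 2) := by gcongr
        _ = a ^ 2 * ((2 * u + 1) / ((u + 1) * d) + u / (d + 1)) := by field_simp; ring
        _ = _ := by rw [hs]
    have hT : (c - S i) * (2 * δ - (c - S i)) ≤ R * (-2 * q - q ^ 2) := by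
      have h1 : (c - S i) * (2 * δ - (c - S i)) ≤
          (c - S i) * (2 * (S i' - S i - a) - (c - S i)) := by
        have : 0 ≤ c - S i := by linarith
        gcongr
      have h2 : 0 ≤ (S i' - S i) * (2 * a - (S i' - S i)) :=
        mul_nonneg (by linarith) (by linarith)
      rw [← hs]
      subst hcq
      nlinarith
    have hT' : (1 - c - (1 - S i')) * (2 * δ' - (1 - c - (1 - S i'))) ≤
        R * (2 * q - q ^ 2) := by
      have h1 := (_root_.abs_le.1 D.abs_sub_le).1
      rw [reflect_apply_sub] at h1
      push_cast at h1
      rw [← hs]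
      subst hcq
      nlinarith [mul_nonneg (mul_nonneg hq ha.le) (show 0 ≤ δ' + a by linarith)]
    have h1 := full_jumps_ineq hu' hd' (q := q) (by
      rcases le_or_gt d u with h | h
      · exact Or.inl (by exact_mod_cast h)
      · exact Or.inr (by exact_mod_cast h)) hq
    calc _ ≤ ((d : ℝ) + 1) * (R * ((2 * u + 1) / ((u + 1) * d) + u / (d + 1)) +
            R * (-2 * q - q ^ 2) - 2 * R) +
          (u + 1) * (R * ((d + 1) / u) + R * (2 * q - q ^ 2) - 2 * R) := by gcongr
      _ = R * (d + 1) * ((2 * u + 1) / ((u + 1) * d) + u / (d + 1) + (u + 1) / u -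
          (2 + 2 * q + q ^ 2 + (u + 1) / (d + 1) * (2 - 2 * q + q ^ 2))) := by field_simp; ring
      _ ≤ 0 := mul_nonpos_of_nonneg_of_nonpos (by positivity) (by linarith)

/-! ### Overlapping up and down jumps -/

lemma Layout.sub_le_of_upMove (L : Layout R k S) (hR : 0 < R) {i : ℤ} {n : ℕ} {x : ℝ}
    (U : UpMove R k S i n x) (hd : 1 ≤ mDown R (S (i + 1))) : S (i + n) - S i ≤ √R / 2 := by
  have ha : 0 < √R := Real.sqrt_pos.2 hR
  have h1 := U.one_le
  have h2 := U.le_mUp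
  have h3 := U.lt
  have hn : (1 : ℝ) ≤ n := by exact_mod_cast h1
  have hu : (n : ℝ) ≤ mUp R (S i) := by exact_mod_cast h2
  refine (sub_le_of_gap_le fun l hl hl' => L.gap_le_of_one_le_mDown_succ hR U.nonneg hl (by omega)
    (by omega) hd).trans ?_
  rw [← mul_div_assoc, div_le_div_iff₀ (by linarith) (by norm_num)]
  nlinarith

/-- If the maximum up jump at `j` is less than `n`, then the interval of samples that cause an up
jump by `n` from a state shortly below `j` reaches beyond `1`, except for its lower end. -/
lemma UpMove.full_le (hR : 0 < R) {i j : ℤ} {n : ℕ} {x : ℝ} (U : UpMove R k S i n x)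
    (h : mUp R (S j) < n) : x - S i - 2 * n * √R ≤ S j - S i - √R := by
  have h1 := (mUp_le_iff hR (x := S j) (n := n - 1)).1 (by omega)
  have h2 := U.le_one
  push_cast at h1
  linarith

/-- The two moves use up the whole allowance at most: an up jump from `i` and a down jump from
`i'` that pass a common gap can be weighted to cancel, and their weighted excess is not positive.
The hypotheses `hd`, `hu` leave out the up jumps whose first gap lies between two states with
`mDown = 0`, and the down jumps whose first gap lies between two states with `mUp = 0`. -/
theorem Layout.excess_add_le (L : Layout R k S) (hR : 0 < R) {i i' : ℤ} {n n' : ℕ} {x x' : ℝ}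
    (c : ℝ) (U : UpMove R k S i n x) (D : UpMove R k (EEDM.reflect k S) (k - 1 - i') n' x')
    (hii' : i < i') (hov : i' - n' < i + n) (hd : 1 ≤ mDown R (S (i + 1)))
    (hu : 1 ≤ mUp R (S (i' - 1))) :
    n' * excess R S c i n x + n * excess R (EEDM.reflect k S) (1 - c) (k - 1 - i') n' x' ≤ 0 := by
  have ha : 0 < √R := Real.sqrt_pos.2 hR
  have hi := U.nonneg
  have hn1 := U.one_le
  have hn := U.le_mUp
  have hink := U.lt
  have hi'k : i' < k := by have := D.nonneg; omega
  have hi'n' : 0 ≤ i' - n' := by have := D.lt; omega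
  have hn'1 := D.one_le
  have hn' : (n' : ℤ) ≤ mDown R (S i') := by
    have := D.le_mUp
    rwa [mUp_reflect, sub_sub_cancel] at this
  have hz : S i' - S i ≤ √R := by
    have h1 := L.sub_le_of_upMove hR U hd
    have h2 := L.reflect.sub_le_of_upMove hR D (by
      rwa [mDown_reflect, show k - 1 - (k - 1 - i' + 1) = i' - 1 by ring])
    rw [show k - 1 - i' + (n' : ℤ) = k - 1 - (i' - n') by ring, reflect_apply_sub,
      reflect_apply_sub] at h2
    have h3 := L.le hi'n' hov.le hink
    linarith
  have hSii' := L.lt i i' hi hii' hi'k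
  have hu1 := L.mUp_anti hR hi hii'.le hi'k
  have hd1 := L.mDown_mono hR hi hii'.le hi'k
  have hi0 := L.mDown_nonneg hR hi (by omega)
  have hi'0 := L.mUp_nonneg hR (show 0 ≤ i' by omega) hi'k
  -- The thresholds of each maximum jump are `2 √R` apart, more than the distance of the states.
  have hu2 : mUp R (S i) ≤ mUp R (S i') + 1 := by
    have h1 := (mUp_le_iff hR (x := S i')).1 le_rfl
    rw [mUp_le_iff hR]; push_cast; linarith
  have hd2 : mDown R (S i') ≤ mDown R (S i) + 1 := by
    have h1 := (mDown_le_iff hR (x := S i)).1 le_rfl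
    rw [mDown_le_iff hR]; push_cast; linarith
  -- It suffices that all passed gaps obey the spacing gap of a segment that allows both jumps.
  have key : ∀ u d : ℤ, (n : ℤ) ≤ u → (n' : ℤ) ≤ d →
      (∀ l, 0 ≤ l → l + 1 < k → i ≤ l → l < i + n → S (l + 1) - S l ≤ √R / (2 * u * d)) →
      (∀ l, 0 ≤ l → l + 1 < k → i' - n' ≤ l → l < i' → S (l + 1) - S l ≤ √R / (2 * u * d)) →
      n' * excess R S c i n x +
        n * excess R (EEDM.reflect k S) (1 - c) (k - 1 - i') n' x' ≤ 0 :=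
    fun u d hnu hnd h h' => excess_add_le_of_gap_le hR U D
      (two_mul_mul_spacing_le ha hn1 hn'1 hnu hnd)
      (fun l h1 h2 => h l (by omega) (by omega) h1 h2)
      (fun l h1 h2 => h' l (by omega) (by omega) h1 h2)
  by_cases hu3 : mUp R (S i') = mUp R (S i)
  · refine key _ _ (hu3 ▸ hn) hn' (fun l h1 h2 h3 h4 => ?_)
      (fun l h1 h2 h3 h4 => L.gap_le_down hR hi'k h4 h1 (by omega) (by omega))
    by_cases hd3 : mDown R (S i') = mDown R (S i)
    · rw [hu3, hd3]
      exact L.gap_le_up' hR hi h3 h2 (by omega) (by omega)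
    · exact L.gap_le_of_mDown_succ hR hi hii' hi'k hu3 (by omega) (by omega) h1 h2 (by omega)
        (by omega)
  by_cases hd3 : mDown R (S i') = mDown R (S i)
  · exact key _ _ hn (hd3 ▸ hn')
      (fun l h1 h2 h3 h4 => L.gap_le_up' hR hi h3 h2 (by omega) (by omega))
      (fun l h1 h2 h3 h4 => L.gap_le_of_mUp_pred hR hi hii' hi'k hd3 (by omega) (by omega) h1 h2
        (by omega) (by omega))
  -- Both maximum jumps change, so there is a state of a third segment in between.
  obtain ⟨p, hip, hpi', hp1, hp2⟩ := L.exists_state_between hR hi hi'k hii' (by omega) (by omega)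
  have h1 := L.mUp_anti hR hi hip.le (by omega)
  have h2 := L.mUp_anti hR (by omega) hpi'.le hi'k
  have h3 := L.mDown_mono hR hi hip.le (by omega)
  have h4 := L.mDown_mono hR (by omega) hpi'.le hi'k
  by_cases hpu : mUp R (S p) = mUp R (S i)
  · refine key (mUp R (S p)) (mDown R (S p)) (by omega) (by omega)
      (fun l h1 h2 h3 h4 => L.gap_le_of_mDown_succ hR hi hip (by omega) hpu (by omega) (by omega)
        h1 h2 (by omega) (by omega))
      (fun l h1 h2 h3 h4 => L.gap_le_of_mUp_pred hR (by omega) hpi' hi'k (by omega) (by omega)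
        (by omega) h1 h2 (by omega) (by omega))
  have hpu' : mUp R (S p) = mUp R (S i') := by omega
  have hpd : mDown R (S p) = mDown R (S i) := by omega
  by_cases hnu : (n : ℤ) ≤ mUp R (S i')
  · exact key _ _ hnu hn'
      (fun l h1 h2 h3 h4 => L.gap_le_of_mDown_succ hR (by omega) hpi' hi'k (by omega) (by omega)
        (by omega) h1 h2 (by omega) (by omega))
      (fun l h1 h2 h3 h4 => L.gap_le_down hR hi'k h4 h1 (by omega) (by omega))
  by_cases hnd : (n' : ℤ) ≤ mDown R (S i)
  · exact key _ _ hn hnd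
      (fun l h1 h2 h3 h4 => L.gap_le_up' hR hi h3 h2 (by omega) (by omega))
      (fun l h1 h2 h3 h4 => L.gap_le_of_mUp_pred hR hi hip (by omega) (by omega) (by omega)
        (by omega) h1 h2 (by omega) (by omega))
  have hpd1 := L.mDown_mono hR (show 0 ≤ i + 1 by omega) (show i + 1 ≤ p by omega) (by omega)
  have hpu1 := L.mUp_anti hR (show 0 ≤ p by omega) (show p ≤ i' - 1 by omega) (by omega)
  obtain ⟨m, hm⟩ := Int.eq_ofNat_of_zero_le hi'0
  obtain ⟨d, hd'⟩ := Int.eq_ofNat_of_zero_le hi0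
  obtain rfl : n = m + 1 := by omega
  obtain rfl : n' = d + 1 := by omega
  have emi : mUp R (S i) = (m : ℤ) + 1 := by omega
  have edi : mDown R (S i') = (d : ℤ) + 1 := by omega
  have hδ := U.full_le hR (j := i') (by omega)
  have hδ' := D.full_le hR (j := k - 1 - i)
    (by rw [mUp_reflect, sub_sub_cancel]; omega)
  rw [reflect_apply_sub, reflect_apply_sub] at hδ'
  have g1 : ∀ l, i ≤ l → l < i + (m + 1 : ℕ) → S (l + 1) - S l ≤ √R / (2 * (m + 1) * d) := by
    intro l h1 h2
    have := L.gap_le_up' hR hi h1 (by omega) (by omega) (by omega)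
    rw [emi, hd'] at this
    push_cast at this
    exact this
  have g2 : ∀ l, i' - (d + 1 : ℕ) ≤ l → l < i' → S (l + 1) - S l ≤ √R / (2 * m * (d + 1)) := by
    intro l h1 h2
    have := L.gap_le_down hR hi'k h2 (by omega) (by omega) (by omega)
    rw [hm, edi] at this
    push_cast at this
    exact this
  rcases le_total (S i) c with hc | hc
  · refine excess_add_le_of_full_jumps hR (by omega) (by omega) D hSii'.le hz hδ
      (by linarith) g1 (fun l h1 h2 => ?_) g2 hc
    have := L.gap_le_of_mDown_succ hR (l := l) (by omega) hpi' hi'k (by omega) (by omega)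
      (by omega) (by omega) (by omega) (by omega) (by omega)
    rw [hm, edi] at this
    push_cast at this
    exact this
  · have := excess_add_le_of_full_jumps (k := k) (S := EEDM.reflect k S) (i := k - 1 - i')
      (i' := k - 1 - i) (u := d) (d := m) (x := x') (x' := x) (c := 1 - c) hR (by omega) (by omega)
      (by rw [reflect_reflect, sub_sub_cancel]; exact U)
      (by rw [reflect_apply_sub, reflect_apply_sub]; linarith)
      (by rw [reflect_apply_sub, reflect_apply_sub]; linarith)
      (by rw [reflect_apply_sub, reflect_apply_sub]; linarith)
      (by rw [reflect_apply_sub, reflect_apply_sub]; linarith)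
      (fun l h1 h2 => reflect_gap_le (i := i') (n := d + 1) (fun l h1 h2 => by
        rw [mul_right_comm]; exact g2 l h1 h2) l h1 h2)
      (fun l h1 h2 => by
        have := L.gap_le_of_mUp_pred hR (l := k - 1 - (l + 1)) hi hip (by omega) (by omega)
          (by omega) (by omega) (by omega) (by omega) (by omega) (by omega)
        rw [emi, hd', show k - 1 - (l + 1) + 1 = k - 1 - l by ring] at this
        simp only [EEDM.reflect]
        push_cast at this
        rw [mul_right_comm]
        linarith)
      (fun l h1 h2 => reflect_gap_le (i := i + (m + 1 : ℕ)) (n := m + 1) (fun l h1 h2 => by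
        rw [mul_right_comm]; exact g1 l (by omega) h2) l (by omega) (by omega))
      (by rw [reflect_apply_sub]; linarith)
    rw [reflect_reflect, sub_sub_cancel, sub_sub_cancel] at this
    linarith

/-! ### The potential -/

lemma Layout.excess_le_mul (L : Layout R k S) (hR : 0 < R) {i : ℤ} {n : ℕ} {x : ℝ}
    (U : UpMove R k S i n x) (c : ℝ) : excess R S c i n x ≤ n * (4 * √R) := by
  have ha : 0 < √R := Real.sqrt_pos.2 hR
  have h1 := U.excess_le hR c
  have hlt := U.lt
  have hi := U.nonneg
  have h2 : area S i n ≤ n := by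
    refine (Finset.sum_le_card_nsmul _ _ 1 fun r hr => ?_).trans (by simp)
    have hr := Finset.mem_range.1 hr
    have h3 := L.mem_Icc i hi (by omega)
    have h4 := L.mem_Icc (i + r) (by omega) (by omega)
    have h5 := L.mem_Icc (i + r + 1) (by omega) (by omega)
    linarith [h3.1, h4.2, h5.2]
  nlinarith

/-- The bounds that the jumps across one gap impose on the increment of the potential there are
compatible, and so are the bounds `± 4 √R`. -/
lemma Layout.exists_increment (L : Layout R k S) (hR : 0 < R) (c : ℝ) (m : ℤ) :
    ∃ e : ℝ, |e| ≤ 4 * √R ∧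
      (∀ i n x, UpMove R k S i n x → 1 ≤ mDown R (S (i + 1)) → i ≤ m → m < i + n →
        excess R S c i n x ≤ n * e) ∧
      (∀ i n x, UpMove R k (EEDM.reflect k S) (k - 1 - i) n x → 1 ≤ mUp R (S (i - 1)) →
        i - n ≤ m → m < i →
        excess R (EEDM.reflect k S) (1 - c) (k - 1 - i) n x ≤ n * -e) := by
  have ha : 0 < √R := Real.sqrt_pos.2 hR
  set A : Set ℝ := insert (-(4 * √R)) {v | ∃ i n x, UpMove R k S i n x ∧
    1 ≤ mDown R (S (i + 1)) ∧ i ≤ m ∧ m < i + n ∧ v = excess R S c i n x / n} with hA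
  have hne : A.Nonempty := ⟨_, Set.mem_insert _ _⟩
  have hle : ∀ v ∈ A, v ≤ 4 * √R := by
    rintro v (rfl | ⟨i, n, x, U, -, -, -, rfl⟩)
    · linarith
    · have h1 : (0 : ℝ) < n := by exact_mod_cast U.one_le
      rw [div_le_iff₀ h1, mul_comm]
      exact L.excess_le_mul hR U c
  have hbdd : BddAbove A := ⟨_, hle⟩
  refine ⟨sSup A, abs_le.2 ⟨le_csSup hbdd (Set.mem_insert _ _), csSup_le hne hle⟩, ?_, ?_⟩
  · intro i n x U hd h1 h2
    have h3 : (0 : ℝ) < n := by exact_mod_cast U.one_le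
    have := le_csSup hbdd (Set.mem_insert_of_mem _ ⟨i, n, x, U, hd, h1, h2, rfl⟩)
    rwa [div_le_iff₀' h3] at this
  · intro i n x D hu h1 h2
    have h3 : (0 : ℝ) < n := by exact_mod_cast D.one_le
    suffices h : sSup A ≤ -(excess R (EEDM.reflect k S) (1 - c) (k - 1 - i) n x / n) by
      rw [le_neg, div_le_iff₀' h3] at h
      exact h
    apply csSup_le hne
    rintro v (rfl | ⟨i', n', x', U, hd, h1', h2', rfl⟩)
    · rw [neg_le_neg_iff, div_le_iff₀' h3]
      exact L.reflect.excess_le_mul hR D _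
    · have h4 : (0 : ℝ) < n' := by exact_mod_cast U.one_le
      have := L.excess_add_le hR c U D (by omega) (by omega) hd hu
      rw [← neg_div, div_le_div_iff₀ h4 h3]
      linarith

/-- Between states with `mDown = 0` the increment `8 k √R` outweighs everything else. -/
lemma Layout.excess_le_sum (L : Layout R k S) (hR : 0 < R) {c : ℝ} {E : ℤ → ℝ}
    (h1 : ∀ m, 1 ≤ mUp R (S m) → mDown R (S (m + 1)) ≤ 0 → E m = 8 * k * √R)
    (h2 : ∀ m, 1 ≤ mUp R (S m) → 1 ≤ mDown R (S (m + 1)) → |E m| ≤ 4 * √R)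
    (h3 : ∀ m i n x, UpMove R k S i n x → 1 ≤ mDown R (S (i + 1)) → i ≤ m → m < i + n →
        excess R S c i n x ≤ n * E m)
    {i : ℤ} {n : ℕ} {x : ℝ} (U : UpMove R k S i n x) :
    excess R S c i n x ≤ ∑ r ∈ Finset.range n, E (i + r) := by
  have ha : 0 < √R := Real.sqrt_pos.2 hR
  have hlt := U.lt
  have hi := U.nonneg
  have hn := U.one_le
  have hu := U.le_mUp
  by_cases hd : 1 ≤ mDown R (S (i + 1))
  · have h4 : (0 : ℝ) < n := by exact_mod_cast hn
    have h5 := Finset.card_nsmul_le_sum (Finset.range n) (fun r : ℕ => E (i + r))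
      (excess R S c i n x / n) fun r hr => by
        rw [div_le_iff₀' h4]
        have := Finset.mem_range.1 hr
        exact h3 _ _ _ _ U hd (by omega) (by omega)
    rw [Finset.card_range, nsmul_eq_mul, mul_div_cancel₀ _ h4.ne'] at h5
    exact h5
  · have h4 := L.excess_le_mul hR U c
    obtain ⟨n, rfl⟩ : ∃ n', n = n' + 1 := ⟨n - 1, by omega⟩
    have hk : ((n : ℝ) + 1) ≤ k := by
      have : (n : ℤ) + 1 ≤ k := by push_cast at hlt; omega
      exact_mod_cast this
    have h5 : ∀ r ∈ Finset.range n, -(4 * √R) ≤ E (i + (r + 1 : ℕ)) := by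
      intro r hr
      have := Finset.mem_range.1 hr
      push_cast at hlt hu
      have h6 := L.mUp_le_add hR hi (r + 1) (by push_cast; omega)
      by_cases h7 : 1 ≤ mDown R (S (i + (r + 1 : ℕ) + 1))
      · exact (abs_le.1 (h2 _ (by push_cast at *; omega) h7)).1
      · rw [h1 _ (by push_cast at *; omega) (by omega)]
        nlinarith
    have h8 := Finset.card_nsmul_le_sum _ _ _ h5
    rw [Finset.card_range, nsmul_eq_mul] at h8
    rw [Finset.sum_range_succ', Nat.cast_zero, add_zero, h1 i (by omega) (by omega)]
    push_cast at *
    nlinarith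

/-- The contribution of an up jump to the regret against the constant predictor `c`. -/
lemma sq_sub_sq_le_of_excess_le {c : ℝ} {i : ℤ} {n : ℕ} {x : ℝ} {E : ℤ → ℝ}
    (h : excess R S c i n x ≤ ∑ r ∈ Finset.range n, E (i + r)) :
    (x - S i) ^ 2 - (x - c) ^ 2 - 2 * R ≤
      ∑ r ∈ Finset.range n, (4 * √R * (c - (S (i + r) + S (i + r + 1)) / 2) + E (i + r)) := by
  have h1 : ∑ r ∈ Finset.range n, (4 * √R * (c - (S (i + r) + S (i + r + 1)) / 2)) =
      4 * √R * (n * (c - S i) - area S i n) := by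
    rw [area, ← Finset.mul_sum]
    simp only [Finset.sum_sub_distrib, Finset.sum_const, Finset.card_range, nsmul_eq_mul]
    ring
  rw [Finset.sum_add_distrib, h1]
  rw [excess] at h
  nlinarith

/-- Up to the constant `2 R`, the loss of each jump against the constant predictor `c` is paid for
by a potential of the states, and this potential is bounded independently of `c`. -/
theorem Layout.exists_potential (L : Layout R k S) (hR : 0 < R) (hk : 0 < k) {c : ℝ}
    (hc : c ∈ Set.Icc (0 : ℝ) 1) :
    ∃ H : ℤ → ℝ, (∀ i, 0 ≤ i → i < k → |H i| ≤ k * (4 * √R + 8 * k * √R)) ∧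
      (∀ i n x, UpMove R k S i n x → (x - S i) ^ 2 - (x - c) ^ 2 - 2 * R ≤ H (i + n) - H i) ∧
      (∀ i n x, UpMove R k (EEDM.reflect k S) (k - 1 - i) n (1 - x) →
        (x - S i) ^ 2 - (x - c) ^ 2 - 2 * R ≤ H (i - n) - H i) := by
  have ha : 0 < √R := Real.sqrt_pos.2 hR
  have hk1 : (1 : ℝ) ≤ k := by exact_mod_cast hk
  choose e he1 he2 he3 using L.exists_increment hR c
  set E : ℤ → ℝ := fun m =>
    if 1 ≤ mDown R (S (m + 1)) then (if 1 ≤ mUp R (S m) then e m else -(8 * k * √R))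
    else 8 * k * √R with hE
  set h : ℤ → ℝ := fun m => 4 * √R * (c - (S m + S (m + 1)) / 2) + E m with hh
  have hup : ∀ i n x, UpMove R k S i n x →
      excess R S c i n x ≤ ∑ r ∈ Finset.range n, E (i + r) := by
    intro i n x U
    refine L.excess_le_sum hR (fun m h1 h2 => ?_) (fun m h1 h2 => ?_)
      (fun m j n x U h1 h2 h3 => ?_) U
    · simp [hE, show ¬ 1 ≤ mDown R (S (m + 1)) by omega]
    · simpa [hE, h1, h2] using he1 m
    · have h4 := U.nonneg
      have h5 := U.lt
      have h6 := L.mDown_mono hR (show 0 ≤ j + 1 by omega) (show j + 1 ≤ m + 1 by omega) (by omega)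
      obtain ⟨r, rfl⟩ := Int.le.dest h2
      have h7 := L.mUp_le_add hR h4 r (by omega)
      have h8 := U.le_mUp
      simp only [hE, if_pos (h1.trans h6), if_pos (show 1 ≤ mUp R (S (j + r)) by omega)]
      exact he2 _ _ _ _ U h1 h2 h3
  have hdown : ∀ i n x, UpMove R k (EEDM.reflect k S) i n x →
      excess R (EEDM.reflect k S) (1 - c) i n x ≤
        ∑ r ∈ Finset.range n, (fun m => -E (k - 2 - m)) (i + r) := by
    intro i n x D
    have key : ∀ m, k - 1 - (m + 1) = k - 2 - m ∧ k - 2 - m + 1 = k - 1 - m :=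
      fun m => ⟨by ring, by ring⟩
    refine L.reflect.excess_le_sum hR (E := fun m => -E (k - 2 - m))
      (fun m h1 h2 => ?_) (fun m h1 h2 => ?_) (fun m j n x D h1 h2 h3 => ?_) D
    · rw [mUp_reflect] at h1
      rw [mDown_reflect, (key m).1] at h2
      simp [hE, (key m).2, h1, show ¬ 1 ≤ mUp R (S (k - 2 - m)) by omega]
    · rw [mUp_reflect] at h1
      rw [mDown_reflect, (key m).1] at h2
      simpa [hE, (key m).2, h1, h2] using he1 (k - 2 - m)
    · have h4 := D.nonneg
      have h5 := D.lt
      have h6 := L.reflect.mDown_mono hR (show 0 ≤ j + 1 by omega) (show j + 1 ≤ m + 1 by omega)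
        (by omega)
      rw [mDown_reflect, mDown_reflect, (key m).1] at h6
      rw [mDown_reflect] at h1
      have h6' := h1.trans h6
      obtain ⟨r, rfl⟩ := Int.le.dest h2
      have h7 := L.reflect.mUp_le_add hR h4 r (by omega)
      have h8 := D.le_mUp
      rw [mUp_reflect] at h7 h8
      rw [mUp_reflect] at h7
      simp only [hE, if_pos h6', (key (j + r)).2,
        if_pos (show 1 ≤ mDown R (S (k - 1 - (j + r))) by omega)]
      have := he3 (k - 2 - (j + r)) (k - 1 - j) n x (by rwa [sub_sub_cancel])
        (by rwa [show k - 1 - j - 1 = k - 1 - (j + 1) by ring]) (by omega) (by omega)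
      rwa [sub_sub_cancel] at this
  have habs : ∀ m, 0 ≤ m → m + 1 < k → |h m| ≤ 4 * √R + 8 * k * √R := by
    intro m h1 h2
    have h3 := L.mem_Icc m h1 (by omega)
    have h4 := L.mem_Icc (m + 1) (by omega) h2
    refine (abs_add_le _ _).trans (add_le_add ?_ ?_)
    · rw [abs_mul, abs_of_pos (by positivity : 0 < 4 * √R)]
      refine mul_le_of_le_one_right (by positivity) (abs_le.2 ⟨?_, ?_⟩) <;>
        linarith [h3.1, h3.2, h4.1, h4.2, hc.1, hc.2]
    · have h5 : 0 < 8 * k * √R := by positivity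
      simp only [hE]
      split_ifs
      · exact (he1 m).trans (by nlinarith)
      · rw [abs_neg, abs_of_pos h5]
      · rw [abs_of_pos h5]
  have hsum : ∀ i : ℤ, ∀ n : ℕ, 0 ≤ i → ∑ r ∈ Finset.range (i + n).toNat, h r =
      ∑ r ∈ Finset.range i.toNat, h r + ∑ r ∈ Finset.range n, h (i + r) := by
    intro i n hi
    lift i to ℕ using hi
    rw [show ((i : ℤ) + n).toNat = i + n by omega, Finset.sum_range_add]
    simp
  refine ⟨fun i => ∑ r ∈ Finset.range i.toNat, h r, fun i hi hik => ?_, fun i n x U => ?_,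
    fun i n x D => ?_⟩
  · refine (Finset.abs_sum_le_sum_abs _ _).trans ?_
    refine (Finset.sum_le_card_nsmul _ _ (4 * √R + 8 * k * √R) fun r hr => ?_).trans ?_
    · have := Finset.mem_range.1 hr
      exact habs r (by omega) (by omega)
    · rw [Finset.card_range, nsmul_eq_mul]
      have : ((i.toNat : ℕ) : ℝ) ≤ k := by
        have : (i.toNat : ℤ) ≤ k := by omega
        exact_mod_cast this
      gcongr
  · have := sq_sub_sq_le_of_excess_le (hup i n x U)
    simp only [hsum i n U.nonneg]
    linarith
  · have h1 := sq_sub_sq_le_of_excess_le (E := fun m => -E (k - 2 - m)) (hdown _ n _ D)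
    have h2 := D.lt
    have h3 := hsum (i - n) n (by omega)
    rw [sub_add_cancel] at h3
    simp only [h3]
    have h4 : ∑ r ∈ Finset.range n, h (i - n + r) = -∑ r ∈ Finset.range n,
        (4 * √R * (1 - c - (EEDM.reflect k S (k - 1 - i + r) +
          EEDM.reflect k S (k - 1 - i + r + 1)) / 2) + -E (k - 2 - (k - 1 - i + r))) := by
      rw [← Finset.sum_neg_distrib, ← Finset.sum_range_reflect]
      refine Finset.sum_congr rfl fun r hr => ?_
      have := Finset.mem_range.1 hr
      rw [show i - (n : ℤ) + (n - 1 - r : ℕ) = i - 1 - r by omega]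
      simp only [hh, EEDM.reflect]
      rw [show k - 1 - (k - 1 - i + (r : ℤ)) = i - 1 - r + 1 by ring,
        show k - 1 - (k - 1 - i + (r : ℤ) + 1) = i - 1 - r by ring,
        show k - 2 - (k - 1 - i + (r : ℤ)) = i - 1 - r by ring]
      ring
    rw [h4]
    rw [reflect_apply_sub] at h1
    linarith

/-! ### The regret of a machine -/

/-- The values of the states, extended by zero to all integers. -/
noncomputable def FSM.extend {k : ℕ} (M : FSM k) (i : ℤ) : ℝ :=
  if h : 0 ≤ i ∧ i < k then M.value ⟨i.toNat, by omega⟩ else 0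

lemma FSM.extend_coe {k : ℕ} (M : FSM k) (i : Fin k) : M.extend (i : ℕ) = M.value i := by
  simp [FSM.extend]

lemma FSM.exists_extend_eq {k : ℕ} (M : FSM k) {i : ℤ} (h0 : 0 ≤ i) (h1 : i < k) :
    ∃ j : Fin k, ((j : ℕ) : ℤ) = i ∧ M.extend i = M.value j :=
  ⟨⟨i.toNat, by omega⟩, by simp [h0], by simp [FSM.extend, h0, h1]⟩

lemma IsEEDM.layout {k : ℕ} {M : FSM k} (h : IsEEDM R M) : Layout R k M.extend where
  lt i j hi hij hj := by
    obtain ⟨a, rfl, ha⟩ := M.exists_extend_eq hi (by omega)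
    obtain ⟨b, rfl, hb⟩ := M.exists_extend_eq (i := j) (by omega) hj
    rw [ha, hb]
    exact h.strictMono (Fin.lt_def.2 (by omega))
  mem_Icc i hi hk := by
    obtain ⟨a, rfl, ha⟩ := M.exists_extend_eq hi hk
    rw [ha]
    exact h.mem_Icc a
  exists_mem_segment mu md hne := by
    obtain ⟨i, hi⟩ := h.exists_mem_segment mu md hne
    exact ⟨(i : ℕ), by omega, by omega, by rwa [M.extend_coe]⟩
  gap_le_left i hi hk := by
    obtain ⟨a, rfl, ha⟩ := M.exists_extend_eq hi (by omega)
    obtain ⟨b, hb, hb'⟩ := M.exists_extend_eq (by omega) hk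
    rw [ha, hb']
    exact (h.gap_le a b (by omega)).1
  gap_le_right i hi hk := by
    obtain ⟨a, rfl, ha⟩ := M.exists_extend_eq hi (by omega)
    obtain ⟨b, hb, hb'⟩ := M.exists_extend_eq (by omega) hk
    rw [ha, hb']
    exact (h.gap_le a b (by omega)).2
  gap_le_of_upper_finer a ha hk hlt i hi hia hai := by
    obtain ⟨a, rfl, ha'⟩ := M.exists_extend_eq ha (by omega)
    obtain ⟨b, hb, hb'⟩ := M.exists_extend_eq (by omega) hk
    obtain ⟨i, rfl, hi'⟩ := M.exists_extend_eq hi (by omega)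
    obtain ⟨j, hj, hj'⟩ := M.exists_extend_eq (i := (i : ℕ) + 1) (by omega) (by omega)
    rw [ha', hb'] at hlt
    rw [ha'] at hai
    rw [hb', hi', hj']
    exact h.gap_le_of_upper_finer a b (by omega) hlt i j (by omega) (Fin.le_def.2 (by omega)) hai
  gap_le_of_lower_finer a ha hk hlt i hi hia hai := by
    obtain ⟨a, rfl, ha'⟩ := M.exists_extend_eq ha (by omega)
    obtain ⟨b, hb, hb'⟩ := M.exists_extend_eq (by omega) hk
    obtain ⟨i, rfl, hi'⟩ := M.exists_extend_eq (i := i) (by omega) (by omega)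
    obtain ⟨j, hj, hj'⟩ := M.exists_extend_eq (i := (i : ℕ) + 1) (by omega) (by omega)
    rw [ha', hb'] at hlt
    rw [hb'] at hai
    rw [ha', hi', hj']
    exact h.gap_le_of_lower_finer a b (by omega) hlt i j (by omega) (Fin.le_def.2 (by omega))
      (by omega)

/-- Every sample in `[0, 1]` belongs to one of the jumps that are allowed at `s`. -/
lemma exists_jump (hR : 0 < R) {s x : ℝ} (hx : x ∈ Set.Icc (0 : ℝ) 1) :
    ∃ j : ℤ, -mDown R s ≤ j ∧ j ≤ mUp R s ∧ s + (2 * (j : ℝ) - 1) * √R ≤ x ∧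
      (x < s + (2 * (j : ℝ) + 1) * √R ∨ (j = mUp R s ∧ x = s + (2 * (j : ℝ) + 1) * √R)) := by
  have ha : 0 < √R := Real.sqrt_pos.2 hR
  have h1 := (mUp_le_iff hR (x := s)).1 le_rfl
  have h2 := (mDown_le_iff hR (x := s)).1 le_rfl
  set j := ⌊(x - s + √R) / (2 * √R)⌋ with hj
  have h3 : (j : ℝ) * (2 * √R) ≤ x - s + √R := by
    rw [← le_div_iff₀ (by positivity)]; exact Int.floor_le _
  have h4 : x - s + √R < (j + 1) * (2 * √R) := by
    rw [← div_lt_iff₀ (by positivity)]; exact Int.lt_floor_add_one _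
  by_cases hju : j ≤ mUp R s
  · refine ⟨j, ?_, hju, by linarith, Or.inl (by linarith)⟩
    rw [hj, Int.le_floor, le_div_iff₀ (by positivity)]
    push_cast
    linarith [hx.1]
  · -- The sample can only be the upper end of the last interval.
    have h5 : (mUp R s : ℝ) + 1 ≤ j := by exact_mod_cast (by omega : mUp R s + 1 ≤ j)
    have h6 : x = s + (2 * (mUp R s : ℝ) + 1) * √R := by
      apply le_antisymm
      · linarith [hx.2]
      · nlinarith
    refine ⟨mUp R s, ?_, le_rfl, by linarith, Or.inr ⟨rfl, h6⟩⟩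
    by_contra! h7
    have h8 : (mUp R s : ℝ) + 1 ≤ -mDown R s := by
      exact_mod_cast (by omega : mUp R s + 1 ≤ -mDown R s)
    nlinarith [hx.1]

lemma IsEEDM.step_le {k : ℕ} {M : FSM k} (hM : IsEEDM R M) (hR : 0 < R) {c : ℝ} {H : ℤ → ℝ}
    (hup : ∀ i n x, UpMove R k M.extend i n x →
      (x - M.extend i) ^ 2 - (x - c) ^ 2 - 2 * R ≤ H (i + n) - H i)
    (hdown : ∀ i n x, UpMove R k (EEDM.reflect k M.extend) (k - 1 - i) n (1 - x) →
      (x - M.extend i) ^ 2 - (x - c) ^ 2 - 2 * R ≤ H (i - n) - H i)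
    (i : Fin k) {x : ℝ} (hx : x ∈ Set.Icc (0 : ℝ) 1) :
    (x - M.value i) ^ 2 - (x - c) ^ 2 - 2 * R ≤
      H ((M.next i x : Fin k) : ℕ) - H ((i : Fin k) : ℕ) := by
  obtain ⟨j, h1, h2, h3, h4⟩ := exists_jump hR (s := M.value i) hx
  have h5 := hM.next_eq i x hx j h1 h2 h3 h4
  have h6 : x ≤ M.value i + (2 * (j : ℝ) + 1) * √R := by
    rcases h4 with h4 | h4
    · exact h4.le
    · exact h4.2.le
  have h7 : ((M.next i x : ℕ) : ℤ) < k := by omega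
  have h8 := i.2
  rw [h5]
  rw [h5] at h7
  rcases lt_trichotomy j 0 with hj | rfl | hj
  · obtain ⟨n, rfl⟩ : ∃ n : ℕ, j = -n := ⟨j.natAbs, by omega⟩
    have := hdown (i : ℕ) n x ⟨by omega, by omega, by omega, ?_, by linarith [hx.1], ?_⟩
    · rwa [M.extend_coe, sub_eq_add_neg _ (n : ℤ)] at this
    · rw [mUp_reflect, sub_sub_cancel, M.extend_coe]
      omega
    · rw [reflect_apply_sub, M.extend_coe, abs_le]
      push_cast at h3 h6
      constructor <;> linarith
  · have h9 : (x - M.value i) ^ 2 ≤ R := by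
      rw [← Real.sq_sqrt hR.le]
      push_cast at h3 h6
      exact sq_le_sq' (by linarith) (by linarith)
    rw [add_zero, sub_self]
    nlinarith [sq_nonneg (x - c)]
  · obtain ⟨n, rfl⟩ : ∃ n : ℕ, j = n := ⟨j.natAbs, by omega⟩
    have := hup (i : ℕ) n x ⟨by omega, by omega, by omega, ?_, hx.2, ?_⟩
    · rwa [M.extend_coe] at this
    · rwa [M.extend_coe]
    · rw [M.extend_coe, abs_le]
      push_cast at h3 h6
      constructor <;> linarith

lemma mean_mem_Icc {x : ℕ → ℝ} (hx : ∀ t, x t ∈ Set.Icc (0 : ℝ) 1) (n : ℕ) :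
    mean x n ∈ Set.Icc (0 : ℝ) 1 := by
  have h0 : 0 ≤ ∑ t ∈ Finset.range n, x t := Finset.sum_nonneg fun t _ => (hx t).1
  have h1 : ∑ t ∈ Finset.range n, x t ≤ n := by
    simpa using Finset.sum_le_card_nsmul (Finset.range n) x 1 fun t _ => (hx t).2
  rw [mean, one_div_mul_eq_div]
  exact ⟨by positivity, div_le_one_of_le₀ h1 (by positivity)⟩

theorem IsEEDM.exists_regret_le {k : ℕ} {M : FSM k} (hM : IsEEDM R M) (hR : 0 < R) :
    ∃ C : ℝ, ∀ (i : Fin k) (x : ℕ → ℝ), (∀ t, x t ∈ Set.Icc (0 : ℝ) 1) → ∀ n : ℕ, 0 < n →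
      M.regret i x n ≤ 2 * R + C / n := by
  refine ⟨2 * (k * (4 * √R + 8 * k * √R)), fun i x hx n hn => ?_⟩
  have hn' : (0 : ℝ) < n := by exact_mod_cast hn
  have hk : (0 : ℤ) < k := by have := i.2; omega
  obtain ⟨H, hH, hup, hdown⟩ := hM.layout.exists_potential hR hk (mean_mem_Icc hx n)
  have h1 : ∀ t, (x t - M.value (M.state i x t)) ^ 2 - (x t - mean x n) ^ 2 - 2 * R ≤
      H ((M.state i x (t + 1) : Fin k) : ℕ) - H ((M.state i x t : Fin k) : ℕ) :=
    fun t => hM.step_le hR hup hdown _ (hx t)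
  have h2 := Finset.sum_le_sum fun t (_ : t ∈ Finset.range n) => h1 t
  rw [Finset.sum_range_sub (fun t => H ((M.state i x t : Fin k) : ℕ)), Finset.sum_sub_distrib,
    Finset.sum_sub_distrib, Finset.sum_const, Finset.card_range, nsmul_eq_mul] at h2
  have h3 := hH ((M.state i x n : Fin k) : ℕ) (by omega) (by omega)
  have h4 := hH ((M.state i x 0 : Fin k) : ℕ) (by omega) (by omega)
  simp only [Int.cast_natCast] at h3 h4
  rw [FSM.regret, ← mul_sub, one_div_mul_eq_div, div_le_iff₀ hn', add_mul,
    div_mul_cancel₀ _ hn'.ne']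
  linarith [(abs_le.1 h3).2, (abs_le.1 h4).1]

theorem IsEEDM.maxRegret_le {k : ℕ} {M : FSM k} (hM : IsEEDM R M) (hR : 0 < R) :
    M.maxRegret ≤ ((2 * R : ℝ) : EReal) := by
  obtain ⟨C, hC⟩ := hM.exists_regret_le hR
  have h1 : Filter.Tendsto (fun n : ℕ => ((2 * R + C / n : ℝ) : EReal)) Filter.atTop
      (nhds ((2 * R : ℝ) : EReal)) := by
    refine EReal.tendsto_coe.2 ?_
    simpa using (tendsto_const_div_atTop_nhds_zero_nat C).const_add (2 * R)
  rw [FSM.maxRegret, ← h1.limsup_eq]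
  refine Filter.limsup_le_limsup ?_
  filter_upwards [Filter.eventually_gt_atTop 0] with n hn
  exact iSup_le fun i => iSup_le fun x => iSup_le fun hx =>
    EReal.coe_le_coe_iff.2 (hC i x hx n hn)

/-! ### Existence of a machine -/

/-- A finely spaced list of values with a state in each segment gives a machine. -/
theorem exists_isEEDM_of_gap_le (hR : 0 < R) {k : ℕ} {v : Fin k → ℝ} {ε : ℝ} (hv : StrictMono v)
    (hv01 : ∀ i, v i ∈ Set.Icc (0 : ℝ) 1) (h0 : ∃ i, v i = 0) (h1 : ∃ i, v i = 1)
    (hseg : ∀ mu md : ℤ, (segment R mu md).Nonempty → ∃ i, v i ∈ segment R mu md)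
    (hgap : ∀ i j : Fin k, (j : ℕ) = i + 1 → v j - v i ≤ ε) (hε : ε ≤ √R)
    (hspace : ∀ s ∈ Set.Icc (0 : ℝ) 1, (ε : EReal) ≤ spacingAt R s) :
    ∃ M : FSM k, IsEEDM R M := by
  have ha : 0 < √R := Real.sqrt_pos.2 hR
  have htel : ∀ (n : ℕ) (i j : Fin k), (j : ℕ) = i + n → v j - v i ≤ n * √R := by
    intro n
    induction n with
    | zero =>
      intro i j h
      rw [show j = i from Fin.ext (by omega)]
      simp
    | succ n ih =>
      intro i j h
      have h2 := ih i ⟨i + n, by omega⟩ rfl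
      have h3 := hgap ⟨i + n, by omega⟩ j (by simp; omega)
      push_cast
      linarith
  have hup : ∀ i : Fin k, ((i : ℕ) : ℤ) + mUp R (v i) < k := by
    intro i
    obtain ⟨l, hl⟩ := h1
    have hil : i ≤ l := hv.le_iff_le.1 (by rw [hl]; exact (hv01 i).2)
    have h2 := htel (l - i) i l (by have := Fin.le_def.1 hil; omega)
    have h3 : mUp R (v i) ≤ ((l - i : ℕ) : ℤ) := by
      rw [mUp_le_iff hR, ← hl]
      push_cast
      nlinarith [Nat.cast_nonneg (α := ℝ) (l - i : ℕ)]
    have := l.2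
    have := Fin.le_def.1 hil
    omega
  have hdown : ∀ i : Fin k, mDown R (v i) ≤ (i : ℕ) := by
    intro i
    obtain ⟨l, hl⟩ := h0
    have hil : l ≤ i := hv.le_iff_le.1 (by rw [hl]; exact (hv01 i).1)
    have h2 := htel (i - l) l i (by have := Fin.le_def.1 hil; omega)
    have h3 : mDown R (v i) ≤ ((i - l : ℕ) : ℤ) := by
      rw [mDown_le_iff hR]
      push_cast
      nlinarith [Nat.cast_nonneg (α := ℝ) (i - l : ℕ)]
    omega
  have hfin : ∀ i j : Fin k, (j : ℕ) = i + 1 → ∀ s ∈ Set.Icc (0 : ℝ) 1,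
      ((v j - v i : ℝ) : EReal) ≤ spacingAt R s := fun i j hij s hs =>
    (EReal.coe_le_coe_iff.2 (hgap i j hij)).trans (hspace s hs)
  -- The jump is determined by the sample, also at the closed end of the last interval.
  refine ⟨⟨v, fun i x => ⟨min (k - 1)
    (((i : ℕ) : ℤ) + min (mUp R (v i)) ⌊(x - v i + √R) / (2 * √R)⌋).toNat,
    by have := i.2; omega⟩⟩, hv, hv01, hseg, fun i j hij => ⟨hfin i j hij _ (hv01 i),
    hfin i j hij _ (hv01 j)⟩, fun a b _ _ i j hij _ _ => hfin i j hij _ (hv01 b),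
    fun a b _ _ i j hij _ _ => hfin i j hij _ (hv01 a), ?_⟩
  intro i x hx j hj1 hj2 hj3 hj4
  dsimp only at *
  have h2 : min (mUp R (v i)) ⌊(x - v i + √R) / (2 * √R)⌋ = j := by
    have h3 : j ≤ ⌊(x - v i + √R) / (2 * √R)⌋ := by
      rw [Int.le_floor, le_div_iff₀ (by positivity)]
      linarith
    rcases hj4 with hj4 | ⟨rfl, -⟩
    · have h4 : ⌊(x - v i + √R) / (2 * √R)⌋ < j + 1 := by
        rw [Int.floor_lt, div_lt_iff₀ (by positivity)]
        push_cast
        linarith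
      omega
    · exact min_eq_left h3
  rw [h2]
  have h3 := hup i
  have h4 := hdown i
  omega

lemma mUp_le_mUp_zero (hR : 0 < R) {x : ℝ} (hx : 0 ≤ x) : mUp R x ≤ mUp R 0 := mUp_anti hR hx

lemma mDown_le_mUp_zero (hR : 0 < R) {x : ℝ} (hx : x ≤ 1) : mDown R x ≤ mUp R 0 := by
  rw [← mDown_one_sub, sub_zero]
  exact mDown_mono hR hx

theorem exists_isEEDM (hR : 0 < R) : ∃ (k : ℕ) (M : FSM k), IsEEDM R M := by
  classical
  have ha : 0 < √R := Real.sqrt_pos.2 hR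
  set m := mUp R 0 with hm
  have hm0 : 0 ≤ m := mUp_nonneg hR zero_le_one
  have hm0' : (0 : ℝ) ≤ m := by exact_mod_cast hm0
  set ε := √R / (2 * ((m : ℝ) + 1) * (m + 1)) with hε
  have hε0 : 0 < ε := by positivity
  obtain ⟨N, hN⟩ := exists_nat_one_div_lt hε0
  set V : Finset ℝ := (Finset.range (N + 2)).image (fun l : ℕ => (l : ℝ) / (N + 1)) ∪
    (Finset.Icc 0 m ×ˢ Finset.Icc 0 m).image (fun p : ℤ × ℤ =>
      if h : (segment R p.1 p.2).Nonempty then h.some else 0) with hV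
  have hgrid : ∀ l : ℕ, l ≤ N + 1 → (l : ℝ) / (N + 1) ∈ V := fun l hl =>
    Finset.mem_union_left _ (Finset.mem_image_of_mem _ (Finset.mem_range.2 (by omega)))
  have hV01 : ∀ x ∈ V, x ∈ Set.Icc (0 : ℝ) 1 := by
    intro x hx
    rcases Finset.mem_union.1 hx with hx | hx
    · obtain ⟨l, hl, rfl⟩ := Finset.mem_image.1 hx
      have hl' : (l : ℝ) ≤ N + 1 := by
        have := Finset.mem_range.1 hl
        exact_mod_cast (by omega : l ≤ N + 1)
      exact ⟨by positivity, div_le_one_of_le₀ hl' (by positivity)⟩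
    · obtain ⟨p, -, rfl⟩ := Finset.mem_image.1 hx
      split_ifs with h
      · exact h.some_mem.1
      · simp
  set v := V.orderEmbOfFin rfl with hv
  have hvV : ∀ i, v i ∈ V := fun i => V.orderEmbOfFin_mem rfl i
  have hVv : ∀ x ∈ V, ∃ i, v i = x := fun x hx => by
    have := V.range_orderEmbOfFin rfl
    rw [← Finset.mem_coe, ← this] at hx
    exact hx
  have hN0 : (0 : ℝ) < N + 1 := by positivity
  refine ⟨V.card, exists_isEEDM_of_gap_le hR (v := v) (ε := ε) v.strictMono
    (fun i => hV01 _ (hvV i)) ?_ ?_ ?_ ?_ ?_ ?_⟩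
  · exact hVv 0 (by simpa using hgrid 0 (by omega))
  · exact hVv 1 (by simpa [hN0.ne'] using hgrid (N + 1) le_rfl)
  · rintro mu md hne
    obtain ⟨x, hx, rfl, rfl⟩ := hne
    have hne : (segment R (mUp R x) (mDown R x)).Nonempty := ⟨x, hx, rfl, rfl⟩
    obtain ⟨i, hi⟩ := hVv hne.some (Finset.mem_union_right _ (Finset.mem_image.2
      ⟨(mUp R x, mDown R x), by
        simp only [Finset.mem_product, Finset.mem_Icc]
        exact ⟨⟨mUp_nonneg hR hx.2, mUp_le_mUp_zero hR hx.1⟩,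
          mDown_nonneg hR hx.1, mDown_le_mUp_zero hR hx.2⟩, by simp only [dif_pos hne]⟩))
    exact ⟨i, hi ▸ hne.some_mem⟩
  · intro i j hij
    -- The next grid point above `v i` bounds `v j`.
    have h0 := (hV01 _ (hvV i)).1
    have h1 := Nat.lt_floor_add_one (v i * (N + 1))
    have h2 := Nat.floor_le (show 0 ≤ v i * ((N : ℝ) + 1) by positivity)
    set l := ⌊v i * ((N : ℝ) + 1)⌋₊
    by_cases hl : l + 1 ≤ N + 1
    · obtain ⟨p, hp⟩ := hVv _ (hgrid (l + 1) hl)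
      have h3 : v i < v p := by
        rw [hp, lt_div_iff₀ hN0]
        push_cast
        exact h1
      have h4 : i < p := v.lt_iff_lt.1 h3
      have h5 : v j ≤ v p := v.monotone (Fin.le_def.2 (by have := Fin.lt_def.1 h4; omega))
      rw [hp] at h5
      push_cast at h5
      have h6 : (l : ℝ) / (N + 1) ≤ v i := by rwa [div_le_iff₀ hN0]
      rw [add_div] at h5
      linarith
    · have h3 : ((N : ℝ) + 1) ≤ l := by exact_mod_cast (by omega : N + 1 ≤ l)
      have h4 : v i < v j := v.lt_iff_lt.2 (Fin.lt_def.2 (by omega))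
      have h5 := (hV01 _ (hvV j)).2
      nlinarith
  · exact div_le_self ha.le (by nlinarith)
  · intro s hs
    rw [spacingAt, spacing]
    split_ifs with h
    · exact le_top
    · have h1 := mUp_nonneg hR hs.2
      have h2 := mDown_nonneg hR hs.1
      have h3 := left_ne_zero_of_mul h
      have h4 := right_ne_zero_of_mul h
      have h5 : (1 : ℝ) ≤ mUp R s := by exact_mod_cast (by omega : 1 ≤ mUp R s)
      have h6 : (1 : ℝ) ≤ mDown R s := by exact_mod_cast (by omega : 1 ≤ mDown R s)
      have h7 : (mUp R s : ℝ) ≤ m := by exact_mod_cast mUp_le_mUp_zero hR hs.1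
      have h8 : (mDown R s : ℝ) ≤ m := by exact_mod_cast mDown_le_mUp_zero hR hs.2
      rw [EReal.coe_le_coe_iff, hε]
      gcongr <;> linarith

end EEDM

theorem mainTheorem3 (Rd : ℝ) (hRd : 0 < Rd) :
    (∃ (k : ℕ) (M : EEDM.FSM k), EEDM.IsEEDM (Rd / 2) M) ∧
    ∀ (k : ℕ) (M : EEDM.FSM k), EEDM.IsEEDM (Rd / 2) M → M.maxRegret ≤ (Rd : EReal) := by
  refine ⟨EEDM.exists_isEEDM (half_pos hRd), fun k M hM => ?_⟩
  have := hM.maxRegret_le (half_pos hRd)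
  rwa [mul_div_cancel₀ _ two_ne_zero] at this
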